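/- Let $\mathcal H^1$ denote one-dimensional Hausdorff measure. A subset $\Gamma$ of a metric space $(\mathcal M,\mathrm{dist})$ is called $1$-Ahlfors-regular with constant $C>0$ if for all $x\in\Gamma$ and all real $0<r\le\operatorname{diam}\Gamma$ (all $r>0$ if $\Gamma$ is unbounded) $$\frac rC\le \mathcal H^1|_\Gamma(\mathrm{Ball}(x,r))<Cr,\qquad \mathrm{Ball}(x,r)=\{y:\mathrm{dist}(x,y)\le r\}.$$ For $x,y,z\in\mathcal M$ let $\partial_1(x,y,z)=\mathrm{dist}(x,y)+\mathrm{dist}(y,z)-\mathrm{dist}(x,z)$, and let $\partial(\{x,y,z\})$ be the minimum of $\partial_1$ over all orderings of the three points. Let $c(x,y,z)$ be the Menger curvature: choose $x',y',z'\in\mathbb C$ with the same pairwise distances as $x,y,z$, and let $c(x,y,z)=1/R$, where $R$ is the radius of the circle through $x',y',z'$, if these are not collinear, and $c(x,y,z)=0$ otherwise. **Theorem.** (1) For every $C>0$ there is a constant $c_1=c_1(C)<\infty$ such that for every metric space $\mathcal M$ and every connected set $\Gamma\subset\mathcal M$ that is $1$-Ahlfors-regular with constant $C$, $$\int_\Gamma\int_\Gamma\int_\Gamma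 \frac{\partial(\{x,y,z\})}{\operatorname{diam}\{x,y,z\}^{3}}\,d\mathcal H^1(z)\,d\mathcal H^1(y)\,d\mathcal H^1(x)\le c_1\,\mathcal H^1(\Gamma),$$ where the integrand is read as $0$ if $x=y=z$. (2) Consequently, for every $C>0$ and $A>1$ there is a constant $c_2=c_2(C,A)<\infty$ such that for all such $\mathcal M$ and $\Gamma$ $$\iiint c^2(x,y,z)\,d\mathcal H^1(z)\,d\mathcal H^1(y)\,d\mathcal H^1(x)\le c_2\,\mathcal H^1(\Gamma),$$ where the integral is over all triples $x,y,z\in\Gamma$ with $\mathrm{dist}(x,y)\le\mathrm{dist}(y,z)\le\mathrm{dist}(x,z)\le A\cdot\mathrm{dist}(x,y)$. -/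

import Mathlib

open MeasureTheory
open scoped NNReal ENNReal

universe u

/-- `K` is 1-Ahlfors-regular with constant `C`: for all `x ∈ K` and all real `0 < r ≤ diam K`
(all `r > 0` if `K` is unbounded), `r / C ≤ H¹(K ∩ Ball(x, r)) < C r`, with closed balls.
The endpoint `r = diam K` is included, so that a bounded `K` satisfies `H¹(K) < C diam K`. -/
def IsOneAhlforsRegular {M : Type*} [MetricSpace M] [MeasurableSpace M] [BorelSpace M]
    (C : ℝ) (K : Set M) : Prop :=
  0 < C ∧ ∀ x ∈ K, ∀ r : ℝ, 0 < r → ENNReal.ofReal r ≤ Metric.ediam K →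
    ENNReal.ofReal (r / C) ≤ (Measure.hausdorffMeasure 1).restrict K (Metric.closedBall x r) ∧
    (Measure.hausdorffMeasure 1).restrict K (Metric.closedBall x r) < ENNReal.ofReal (C * r)

/-- The excess `∂₁(x, y, z)` of an ordered triple. -/
noncomputable def excess {M : Type*} [MetricSpace M] (x y z : M) : ℝ :=
  dist x y + dist y z - dist x z

/-- The quantity `∂({x, y, z})` of an unordered triple: the minimum of `∂₁` over all orderings.
As `∂₁(x, y, z) = ∂₁(z, y, x)`, one ordering for each choice of the middle point suffices. -/
noncomputable def minExcess {M : Type*} [MetricSpace M] (x y z : M) : ℝ :=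
  min (excess x y z) (min (excess y z x) (excess z x y))

/-- The minimum is attained when the longest side joins the two end points. -/
theorem minExcess_eq_excess {M : Type*} [MetricSpace M] {x y z : M}
    (h₁ : dist x y ≤ dist y z) (h₂ : dist y z ≤ dist x z) :
    minExcess x y z = excess x y z := by
  unfold minExcess excess
  rw [dist_comm z x, dist_comm y x, dist_comm z y, min_eq_left]
  exact le_min (by linarith) (by linarith)

/-- `T` is a nondegenerate comparison triangle in the plane for the points `x`, `y`, `z`. -/
def IsComparisonTriangle {M : Type*} [MetricSpace M] (x y z : M)
    (T : Affine.Triangle ℝ ℂ) : Prop :=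
  dist (T.points 0) (T.points 1) = dist x y ∧
  dist (T.points 1) (T.points 2) = dist y z ∧
  dist (T.points 0) (T.points 2) = dist x z

open Classical in
/-- The Menger curvature `c(x, y, z)`: the inverse of the circumradius of a comparison triangle
in `ℂ` (all of these are congruent), and `0` if the comparison points are collinear, that is, if
there is no nondegenerate comparison triangle (in particular if two of the points coincide). -/
noncomputable def mengerCurvature {M : Type*} [MetricSpace M] (x y z : M) : ℝ :=
  if h : ∃ T : Affine.Triangle ℝ ℂ, IsComparisonTriangle x y z T then
    1 / h.choose.circumradius
  else 0

/-- The value does not depend on the choice of the comparison triangle. -/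
theorem mengerCurvature_eq {M : Type*} [MetricSpace M] {x y z : M} {T : Affine.Triangle ℝ ℂ}
    (hT : IsComparisonTriangle x y z T) : mengerCurvature x y z = 1 / T.circumradius := by
  have key : ∀ S : Affine.Triangle ℝ ℂ, IsComparisonTriangle x y z S →
      dist x z / Real.sin (Real.arccos
        ((dist x y * dist x y + dist y z * dist y z - dist x z * dist x z) / 2 /
          (dist x y * dist y z))) = 2 * S.circumradius := by
    intro S hS
    have h := Affine.Triangle.dist_div_sin_angle_eq_two_mul_circumradius S
      (i₁ := 0) (i₂ := 1) (i₃ := 2) (by decide) (by decide) (by decide)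
    rw [← h, EuclideanGeometry.angle, InnerProductGeometry.angle,
      real_inner_eq_norm_mul_self_add_norm_mul_self_sub_norm_sub_mul_self_div_two]
    simp only [vsub_sub_vsub_cancel_right, ← dist_eq_norm_vsub]
    rw [hS.1, dist_comm (S.points 2) (S.points 1), hS.2.1, hS.2.2]
  have h : ∃ T : Affine.Triangle ℝ ℂ, IsComparisonTriangle x y z T := ⟨T, hT⟩
  unfold mengerCurvature
  rw [dif_pos h]
  have h₁ := key _ h.choose_spec
  have h₂ := key _ hT
  congr 1
  linarith

/-- The ordered triples with `dist x y ≤ dist y z ≤ dist x z ≤ A * dist x y`. -/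
def comparableTriples (M : Type*) [MetricSpace M] (A : ℝ) : Set (M × M × M) :=
  {p | dist p.1 p.2.1 ≤ dist p.2.1 p.2.2 ∧ dist p.2.1 p.2.2 ≤ dist p.1 p.2.2 ∧
    dist p.1 p.2.2 ≤ A * dist p.1 p.2.1}

/-! The set is replaced by a discrete path of `n` points with pseudometric `D` and steps at most
`1`, and the triple integral by a triple sum that must be `O(n)`. If the diameter of a triple is
measured in the parameter, telescoping suffices: with `S a = ∑ s, D s (s + a)`, the excesses of all
ordered triples with gaps `a` and `b` add up to at most `S a + S b - S (a + b)`, and after weighting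
by `(a + b) ^ (-3)` everything cancels up to `n`, because `S a ≤ n * a` (`sum_ordered_excess_le`).

The difficulty is that the path may return near itself, so that `D` is much smaller than the
parameter gap. Consider a triple `s`, `t`, `u` of diameter about `2 ^ k`. If `t` and `u` are close,
relative to the excess, to points `a`, `b` on the arc of length about `C * 2 ^ k` around `s`, then
`s`, `a`, `b` has comparable excess; regularity counts the pairs `t`, `u`, and telescoping applies
to `s`, `a`, `b`. Otherwise one of them, say `t`, sees a `Jump`: `s` is near `t`, but the arc around
`s` avoids a ball about `t`.

Jumps are rare. A long arc with nearby ends contains a triple of large excess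
(`exists_large_excess`), and by telescoping such triples occur at boundedly many scales on average
over the path (`sum_farExcess_le`). Between them, jumps at separated scales have witnesses on
disjoint long arcs, all in one ball, which regularity limits (`card_jumps_le`). Hence jumps avoiding
a ball of radius `2 ^ (k - i)` number `O((i + 1) * n)` (`sum_jump_le`), while their weight decays
like `2 ^ (-i)`.

The path comes from a walk through an `ε`-net, which is connected as a graph. Nearest-point
projections to the path turn the integral into the discrete sum, and Fatou's lemma lets `ε` tend to
`0`. The curvature bound then follows pointwise from Heron's formula. -/

/-! ### Two estimates for series -/

open Finset in
-- Write `A h` for the sum of `S a` over `1 ≤ a < h`. The term of length `h` is `(2 * A h - (h - 1)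
-- * S h) / h ^ 3`, which is nearly the drop of `A h / ((h - 1) * h)` from `h` to `h + 1`. The
-- second summand on the left is what remains after telescoping.
theorem telescoping_weights (n : ℝ) (hn : 0 ≤ n) (S : ℕ → ℝ) (hS0 : ∀ a, 0 ≤ S a)
    (hS : ∀ a, S a ≤ n * a) (N : ℕ) :
    ∑ h ∈ Ico 1 (N + 2), (∑ a ∈ Ico 1 h, (S a + S (h - a) - S h)) / (h : ℝ) ^ 3
      + (∑ a ∈ Ico 1 (N + 2), S a) / ((N + 1) * (N + 2)) ≤ n * (1 - 1 / (N + 2)) := by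
  induction N with
  | zero =>
    have := hS 1
    norm_num at this ⊢
    linarith
  | succ N ih =>
    rw [sum_Ico_succ_top (by omega : 1 ≤ N + 2), sum_Ico_succ_top (by omega : 1 ≤ N + 2)]
    have hrefl : ∑ a ∈ Ico 1 (N + 2), S (N + 2 - a) = ∑ a ∈ Ico 1 (N + 2), S a := by
      refine sum_nbij' (fun a => N + 2 - a) (fun a => N + 2 - a) ?_ ?_ ?_ ?_ ?_ <;>
        intro a ha <;> simp only [mem_Ico] at ha ⊢
      · omega
      · omega
      · omega
      · omega
    have hsplit : ∑ a ∈ Ico 1 (N + 2), (S a + S (N + 2 - a) - S (N + 2))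
        = 2 * ∑ a ∈ Ico 1 (N + 2), S a - (N + 1) * S (N + 2) := by
      rw [sum_sub_distrib, sum_add_distrib, hrefl]
      simp
      ring
    rw [hsplit]
    set A := ∑ a ∈ Ico 1 (N + 2), S a with hA
    have hA0 : 0 ≤ A := sum_nonneg fun a _ => hS0 a
    set x : ℝ := (N : ℝ) with hx
    have hx0 : 0 ≤ x := Nat.cast_nonneg N
    have h1 := hS (N + 2)
    push_cast at h1 ⊢
    rw [← hx] at h1 ⊢
    -- With `h = N + 2`, the only positive error is `S h / (h ^ 3 * (h + 1))`; as `S h ≤ n * h`, it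
    -- is at most `n * (1 / h - 1 / (h + 1))`.
    have key : (2 * A - (x + 1) * S (N + 2)) / (x + 2) ^ 3
        + (A + S (N + 2)) / ((x + 1 + 1) * (x + 1 + 2)) - A / ((x + 1) * (x + 2))
        ≤ n * (1 / (x + 2) - 1 / (x + 1 + 2)) := by
      have e1 : (2 * A - (x + 1) * S (N + 2)) / (x + 2) ^ 3
        + (A + S (N + 2)) / ((x + 1 + 1) * (x + 1 + 2)) - A / ((x + 1) * (x + 2))
        = S (N + 2) / ((x + 2) ^ 3 * (x + 3))
          - A * (2 / ((x + 1) * (x + 2) ^ 3 * (x + 3))) := by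
        field_simp
        ring
      have e2 : n * (1 / (x + 2) - 1 / (x + 1 + 2)) =
          n * (x + 2) ^ 2 / ((x + 2) ^ 3 * (x + 3)) := by
        field_simp
        ring
      rw [e1, e2]
      have : S (N + 2) / ((x + 2) ^ 3 * (x + 3)) ≤ n * (x + 2) ^ 2 / ((x + 2) ^ 3 * (x + 3)) := by
        gcongr
        nlinarith [mul_nonneg hn hx0, mul_nonneg hn (mul_nonneg hx0 hx0)]
      have : 0 ≤ A * (2 / ((x + 1) * (x + 2) ^ 3 * (x + 3))) := by positivity
      linarith
    linarith

/-- The sum over `k < m` of `8 ^ (-k)` over the dyadic scales `2 ^ k ≥ x`. -/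
theorem sum_dyadic_inv_cube_le {x : ℝ} (hx : 0 < x) (m : ℕ) :
    ∑ k ∈ Finset.range m, (if x ≤ 2 ^ k then 1 / ((2 : ℝ) ^ k) ^ 3 else 0) ≤ 2 / x ^ 3 := by
  have zero : ∀ m : ℕ, (2 : ℝ) ^ m < 2 * x →
      ∑ k ∈ Finset.range m, (if x ≤ 2 ^ k then 1 / ((2 : ℝ) ^ k) ^ 3 else 0) = 0 := by
    intro m hm
    refine Finset.sum_eq_zero fun k hk => if_neg ?_
    have : (2 : ℝ) ^ (k + 1) ≤ 2 ^ m :=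
      pow_le_pow_right₀ (by norm_num) (by simpa using hk)
    rw [pow_succ] at this
    linarith
  have key : ∀ m : ℕ, x ≤ 2 ^ m →
      ∑ k ∈ Finset.range m, (if x ≤ 2 ^ k then 1 / ((2 : ℝ) ^ k) ^ 3 else 0)
        ≤ 8 / 7 * (1 / x ^ 3 - 1 / ((2 : ℝ) ^ m) ^ 3) := by
    intro m
    induction m with
    | zero =>
      intro h
      have : 1 ≤ 1 / x ^ 3 := by
        rw [le_div_iff₀ (by positivity), one_mul]
        exact pow_le_one₀ hx.le (by simpa using h)
      simp only [Finset.range_zero, Finset.sum_empty, pow_zero, one_pow, div_one]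
      linarith
    | succ m ih =>
      intro h
      rw [Finset.sum_range_succ]
      by_cases hm : x ≤ 2 ^ m
      · have e : 1 / ((2 : ℝ) ^ (m + 1)) ^ 3 = 1 / 8 * (1 / ((2 : ℝ) ^ m) ^ 3) := by
          rw [pow_succ (2 : ℝ) m]
          field_simp
          norm_num
        rw [if_pos hm, e]
        linarith [ih hm]
      · rw [if_neg hm, zero m (by linarith), add_zero]
        have : 1 / ((2 : ℝ) ^ (m + 1)) ^ 3 ≤ 1 / x ^ 3 := by gcongr
        linarith
  by_cases hm : x ≤ 2 ^ m
  · refine (key m hm).trans ?_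
    have : 0 ≤ 1 / ((2 : ℝ) ^ m) ^ 3 := by positivity
    have : 0 ≤ 1 / x ^ 3 := by positivity
    have e : 2 / x ^ 3 = 2 * (1 / x ^ 3) := by ring
    rw [e]
    linarith
  · rw [zero m (by linarith)]
    positivity

/-! ### Regular discrete paths and telescoping along the path -/

/-- A pseudometric `D` on parameters `s : ℕ`, seen as a discrete path with steps at most `1`, whose
first `n` parameters satisfy the upper Ahlfors bound with constant `C`. -/
structure IsRegularPath (C : ℝ) (n : ℕ) (D : ℕ → ℕ → ℝ) : Prop where
  self : ∀ s, D s s = 0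
  comm : ∀ s t, D s t = D t s
  tri : ∀ s t u, D s u ≤ D s t + D t u
  step : ∀ s, D s (s + 1) ≤ 1
  card : ∀ s r, 1 ≤ r → (((Finset.range n).filter fun t => D s t ≤ r).card : ℝ) ≤ C * r
  sep : ∀ s t, D s t = 0 ∨ 1 / 2 ≤ D s t

/-- The excess of an ordered triple of parameters. -/
def pathExcess (D : ℕ → ℕ → ℝ) (s t u : ℕ) : ℝ := D s t + D t u - D s u

/-- The minimal excess of a triple of parameters. -/
def pathMinExcess (D : ℕ → ℕ → ℝ) (s t u : ℕ) : ℝ :=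
  min (pathExcess D s t u) (min (pathExcess D t u s) (pathExcess D u s t))

/-- The diameter of a triple of parameters. -/
def pathDiam (D : ℕ → ℕ → ℝ) (s t u : ℕ) : ℝ := max (D s t) (max (D t u) (D s u))

namespace IsRegularPath

variable {C : ℝ} {n : ℕ} {D : ℕ → ℕ → ℝ}

theorem nonneg (h : IsRegularPath C n D) (s t : ℕ) : 0 ≤ D s t := by
  have := h.tri s t s
  rw [h.self, h.comm t s] at this
  linarith

theorem dist_add_le (h : IsRegularPath C n D) (s a : ℕ) : D s (s + a) ≤ a := by
  induction a with
  | zero => simp [h.self]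
  | succ a ih =>
    have h1 := h.tri s (s + a) (s + a + 1)
    have h2 := h.step (s + a)
    push_cast
    rw [← add_assoc]
    linarith

theorem dist_le_sub (h : IsRegularPath C n D) {s t : ℕ} (hst : s ≤ t) : D s t ≤ t - s := by
  obtain ⟨a, rfl⟩ := Nat.exists_eq_add_of_le hst
  simpa using h.dist_add_le s a

theorem dist_le_abs (h : IsRegularPath C n D) (s t : ℕ) : D s t ≤ |(s : ℝ) - t| := by
  rcases le_total s t with hst | hst
  · rw [abs_sub_comm]
    exact (h.dist_le_sub hst).trans (le_abs_self _)
  · rw [h.comm]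
    exact (h.dist_le_sub hst).trans (le_abs_self _)

theorem pathExcess_nonneg (h : IsRegularPath C n D) (s t u : ℕ) : 0 ≤ pathExcess D s t u := by
  have := h.tri s t u
  unfold pathExcess
  linarith

theorem pathMinExcess_nonneg (h : IsRegularPath C n D) (s t u : ℕ) : 0 ≤ pathMinExcess D s t u :=
  le_min (h.pathExcess_nonneg _ _ _)
    (le_min (h.pathExcess_nonneg _ _ _) (h.pathExcess_nonneg _ _ _))

theorem pathExcess_le_two_mul_left (h : IsRegularPath C n D) (s t u : ℕ) :
    pathExcess D s t u ≤ 2 * D s t := by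
  have := h.tri t s u
  rw [h.comm t s] at this
  unfold pathExcess
  linarith

theorem pathExcess_le_two_mul_right (h : IsRegularPath C n D) (s t u : ℕ) :
    pathExcess D s t u ≤ 2 * D t u := by
  have := h.tri s u t
  rw [h.comm u t] at this
  unfold pathExcess
  linarith

theorem pathExcess_perturb (h : IsRegularPath C n D) (s t u s' t' u' : ℕ) :
    pathExcess D s t u ≤ pathExcess D s' t' u' + 2 * D s s' + 2 * D t t' + 2 * D u u' := by
  have h1 := h.tri s s' t
  have h2 := h.tri s' t' t
  have h3 := h.tri t t' u
  have h4 := h.tri t' u' u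
  have h5 := h.tri s' s u'
  have h6 := h.tri s u u'
  rw [h.comm t' t] at h2
  rw [h.comm u' u] at h4
  rw [h.comm s' s] at h5
  unfold pathExcess
  linarith

theorem pathMinExcess_perturb (h : IsRegularPath C n D) (s t u s' t' u' : ℕ) :
    pathMinExcess D s t u ≤ pathMinExcess D s' t' u' + 2 * D s s' + 2 * D t t' + 2 * D u u' := by
  have h1 := h.pathExcess_perturb s t u s' t' u'
  have h2 := h.pathExcess_perturb t u s t' u' s'
  have h3 := h.pathExcess_perturb u s t u' s' t'
  unfold pathMinExcess
  rcases min_choice (pathExcess D s' t' u') (min (pathExcess D t' u' s') (pathExcess D u' s' t'))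
    with h' | h'
  · rw [h']
    exact (min_le_left _ _).trans h1
  · rw [h']
    rcases min_choice (pathExcess D t' u' s') (pathExcess D u' s' t') with h'' | h''
    · rw [h'']
      exact ((min_le_right _ _).trans (min_le_left _ _)).trans (by linarith)
    · rw [h'']
      exact ((min_le_right _ _).trans (min_le_right _ _)).trans (by linarith)

theorem pathMinExcess_le_pathDiam (h : IsRegularPath C n D) (s t u : ℕ) :
    pathMinExcess D s t u ≤ pathDiam D s t u := by
  have h1 : pathMinExcess D s t u ≤ pathExcess D s t u := min_le_left _ _
  have h2 : pathMinExcess D s t u ≤ pathExcess D t u s := (min_le_right _ _).trans (min_le_left _ _)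
  have h3 : pathMinExcess D s t u ≤ pathExcess D u s t :=
    (min_le_right _ _).trans (min_le_right _ _)
  have h4 : D s t ≤ pathDiam D s t u := le_max_left _ _
  have h5 : D t u ≤ pathDiam D s t u := (le_max_left _ _).trans (le_max_right _ _)
  have h6 : D s u ≤ pathDiam D s t u := (le_max_right _ _).trans (le_max_right _ _)
  unfold pathExcess at h1 h2 h3
  rw [h.comm u s, h.comm t s] at h2
  rw [h.comm u s, h.comm u t] at h3
  linarith

/-- Each of the two short sides runs over translates of one gap, so its sum only grows when
completed to all starting points. -/
theorem sum_excess_fixed_lengths (h : IsRegularPath C n D) {a b : ℕ} :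
    ∑ s ∈ Finset.range (n - (a + b)), pathExcess D s (s + a) (s + (a + b)) ≤
      ∑ s ∈ Finset.range (n - a), D s (s + a) + ∑ s ∈ Finset.range (n - b), D s (s + b)
        - ∑ s ∈ Finset.range (n - (a + b)), D s (s + (a + b)) := by
  unfold pathExcess
  rw [Finset.sum_sub_distrib, Finset.sum_add_distrib]
  have h1 : ∑ s ∈ Finset.range (n - (a + b)), D s (s + a)
      ≤ ∑ s ∈ Finset.range (n - a), D s (s + a) :=
    Finset.sum_le_sum_of_subset_of_nonneg (Finset.range_mono (by omega))
      fun _ _ _ => h.nonneg _ _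
  have h2 : ∑ s ∈ Finset.range (n - (a + b)), D (s + a) (s + (a + b))
      ≤ ∑ s ∈ Finset.range (n - b), D s (s + b) := by
    rw [← Finset.sum_image (f := fun s => D s (s + b)) (s := Finset.range (n - (a + b)))
      (g := fun s => s + a) (by intro x _ y _ hxy; simpa using hxy) |>.trans
        (Finset.sum_congr rfl fun s _ => by rw [add_assoc])]
    refine Finset.sum_le_sum_of_subset_of_nonneg ?_ fun _ _ _ => h.nonneg _ _
    intro x hx
    simp only [Finset.mem_image, Finset.mem_range] at hx ⊢
    omega
  linarith

/-- Telescoping over all scales for the triples ordered along the path. -/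
theorem sum_ordered_excess_le (h : IsRegularPath C n D) :
    ∑ s ∈ Finset.range n, ∑ t ∈ Finset.range n, ∑ u ∈ Finset.range n,
      (if s < t ∧ t < u then pathExcess D s t u / ((u : ℝ) - s) ^ 3 else 0) ≤ n := by
  set S : ℕ → ℝ := fun a => ∑ s ∈ Finset.range (n - a), D s (s + a) with hS
  have hS0 : ∀ a, 0 ≤ S a := fun a => Finset.sum_nonneg fun _ _ => h.nonneg _ _
  have hSle : ∀ a, S a ≤ n * a := by
    intro a
    calc S a ≤ ∑ s ∈ Finset.range (n - a), (a : ℝ) := Finset.sum_le_sum fun s _ => h.dist_add_le s a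
      _ = (n - a : ℕ) * (a : ℝ) := by simp
      _ ≤ n * a := by gcongr; omega
  have main := telescoping_weights n (Nat.cast_nonneg n) S hS0 hSle n
  -- Reindexing by total length `l = u - s`, first gap `a = t - s` and starting point `s`.
  have e : ∑ s ∈ Finset.range n, ∑ t ∈ Finset.range n, ∑ u ∈ Finset.range n,
      (if s < t ∧ t < u then pathExcess D s t u / ((u : ℝ) - s) ^ 3 else 0)
      = ∑ l ∈ Finset.Ico 1 (n + 2), ∑ a ∈ Finset.Ico 1 l, ∑ s ∈ Finset.range (n - l),
        pathExcess D s (s + a) (s + l) / (l : ℝ) ^ 3 := by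
    simp only [Finset.sum_sigma', ← Finset.sum_filter]
    refine Finset.sum_nbij' (fun p => ⟨p.2.2 - p.1, p.2.1 - p.1, p.1⟩)
      (fun q => ⟨q.2.2, q.2.2 + q.2.1, q.2.2 + q.1⟩) ?_ ?_ ?_ ?_ ?_
    all_goals
      rintro ⟨x, y, z⟩ hp
      simp only [Finset.mem_filter, Finset.mem_sigma, Finset.mem_range, Finset.mem_Ico] at hp ⊢
    · omega
    · omega
    · simp only [Sigma.mk.injEq, heq_eq_eq, true_and]; omega
    · simp only [Sigma.mk.injEq, heq_eq_eq, and_true]; omega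
    · rw [show x + (y - x) = y by omega, show x + (z - x) = z by omega,
        Nat.cast_sub (by omega : x ≤ z)]
  rw [e]
  have step : ∀ l ∈ Finset.Ico 1 (n + 2),
      ∑ a ∈ Finset.Ico 1 l, ∑ s ∈ Finset.range (n - l),
        pathExcess D s (s + a) (s + l) / (l : ℝ) ^ 3
      ≤ (∑ a ∈ Finset.Ico 1 l, (S a + S (l - a) - S l)) / (l : ℝ) ^ 3 := by
    intro l _
    rw [Finset.sum_div]
    refine Finset.sum_le_sum fun a ha => ?_
    rw [← Finset.sum_div]
    gcongr
    obtain ⟨b, rfl⟩ := Nat.exists_eq_add_of_le (Finset.mem_Ico.1 ha).2.le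
    rw [Nat.add_sub_cancel_left]
    exact h.sum_excess_fixed_lengths
  refine (Finset.sum_le_sum step).trans ?_
  have : 0 ≤ (∑ a ∈ Finset.Ico 1 (n + 2), S a) / (((n : ℝ) + 1) * (n + 2)) :=
    div_nonneg (Finset.sum_nonneg fun a _ => hS0 a) (by positivity)
  have : 0 ≤ (n : ℝ) * (1 / (n + 2)) := by positivity
  linarith

end IsRegularPath

/-! ### Unordered triples and the packing of scales of large excess -/

theorem sum_range_shift_le {F : ℕ → ℝ} (hF : ∀ x, 0 ≤ F x) {a p n : ℕ} (h : a + p ≤ n) :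
    ∑ i ∈ Finset.range p, F (a + i) ≤ ∑ x ∈ Finset.range n, F x := by
  rw [← Finset.sum_image (f := F) (g := fun i => a + i)
    (by intro x _ y _ hxy; simpa using hxy)]
  refine Finset.sum_le_sum_of_subset_of_nonneg ?_ fun _ _ _ => hF _
  intro x hx
  simp only [Finset.mem_image, Finset.mem_range] at hx ⊢
  omega

/-- There is a triple of large excess at scale `2 ^ k` on the path near `s`. -/
def FarExcess (D : ℕ → ℕ → ℝ) (n : ℕ) (η : ℝ) (s k : ℕ) : Prop :=
  ∃ a b c, a < b ∧ b < c ∧ c < n ∧ (c : ℝ) - a ≤ 2 * 2 ^ k ∧ D s a ≤ 2 * 2 ^ k ∧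
    η * 2 ^ k ≤ pathExcess D a b c

namespace IsRegularPath

variable {C : ℝ} {n : ℕ} {D : ℕ → ℕ → ℝ}

theorem pathExcess_reverse (h : IsRegularPath C n D) (s t u : ℕ) :
    pathExcess D s t u = pathExcess D u t s := by
  unfold pathExcess
  rw [h.comm s t, h.comm t u, h.comm s u]
  ring

/-- Sorting the parameters, the minimum is at most the excess of the sorted triple, whose length is
at most twice the maximal gap from `s`; cubing gives the `8`. If two parameters coincide, the
minimal excess vanishes. -/
theorem pathMinExcess_div_le (h : IsRegularPath C n D) (s t u : ℕ) :
    pathMinExcess D s t u / max |(s : ℝ) - t| |(s : ℝ) - u| ^ 3 ≤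
      8 * ((if s < t ∧ t < u then pathExcess D s t u / ((u : ℝ) - s) ^ 3 else 0)
        + (if s < u ∧ u < t then pathExcess D s u t / ((t : ℝ) - s) ^ 3 else 0)
        + (if t < s ∧ s < u then pathExcess D t s u / ((u : ℝ) - t) ^ 3 else 0)
        + (if t < u ∧ u < s then pathExcess D t u s / ((s : ℝ) - t) ^ 3 else 0)
        + (if u < s ∧ s < t then pathExcess D u s t / ((t : ℝ) - u) ^ 3 else 0)
        + (if u < t ∧ t < s then pathExcess D u t s / ((s : ℝ) - u) ^ 3 else 0)) := by
  have o : ∀ x y z : ℕ,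
      0 ≤ (if x < y ∧ y < z then pathExcess D x y z / ((z : ℝ) - x) ^ 3 else 0) := by
    intro x y z
    split_ifs with hx
    · have : (x : ℝ) < z := by exact_mod_cast hx.1.trans hx.2
      have := h.pathExcess_nonneg x y z
      have : 0 < (z : ℝ) - x := by linarith
      positivity
    · exact le_rfl
  have o1 := o s t u
  have o2 := o s u t
  have o3 := o t s u
  have o4 := o t u s
  have o5 := o u s t
  have o6 := o u t s
  have m1 : pathMinExcess D s t u ≤ pathExcess D s t u := min_le_left _ _
  have m2 : pathMinExcess D s t u ≤ pathExcess D t u s := (min_le_right _ _).trans (min_le_left _ _)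
  have m3 : pathMinExcess D s t u ≤ pathExcess D u s t :=
    (min_le_right _ _).trans (min_le_right _ _)
  have m0 := h.pathMinExcess_nonneg s t u
  have w1 := le_max_left |(s : ℝ) - t| |(s : ℝ) - u|
  have w2 := le_max_right |(s : ℝ) - t| |(s : ℝ) - u|
  set w := max |(s : ℝ) - t| |(s : ℝ) - u|
  have b1 := abs_le.1 w1
  have b2 := abs_le.1 w2
  have key : ∀ x y z : ℕ, x < y → y < z → pathMinExcess D s t u ≤ pathExcess D x y z →
      (z : ℝ) - x ≤ 2 * w → pathMinExcess D s t u / w ^ 3 ≤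
        8 * (if x < y ∧ y < z then pathExcess D x y z / ((z : ℝ) - x) ^ 3 else 0) := by
    intro x y z hxy hyz hm hw
    rw [if_pos ⟨hxy, hyz⟩]
    have hxz : (x : ℝ) < z := by exact_mod_cast hxy.trans hyz
    have hd : 0 < (z : ℝ) - x := by linarith
    calc pathMinExcess D s t u / w ^ 3 ≤ pathExcess D x y z / (((z : ℝ) - x) / 2) ^ 3 := by
          gcongr
          · exact h.pathExcess_nonneg _ _ _
          · linarith
      _ = _ := by field_simp; norm_num
  rcases lt_trichotomy s t with hst | hst | hst
  · rcases lt_trichotomy t u with htu | htu | htu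
    · have := key s t u hst htu m1 (by linarith)
      linarith
    · have : pathExcess D s t u = 0 := by unfold pathExcess; rw [htu, h.self]; ring
      rw [show pathMinExcess D s t u = 0 by linarith, zero_div]
      linarith
    · rcases lt_trichotomy s u with hsu | hsu | hsu
      · have := key s u t hsu htu (by rw [h.pathExcess_reverse]; exact m2) (by linarith)
        linarith
      · have : pathExcess D t u s = 0 := by unfold pathExcess; rw [hsu, h.self]; ring
        rw [show pathMinExcess D s t u = 0 by linarith, zero_div]
        linarith
      · have := key u s t hsu hst m3 (by linarith)
        linarith
  · have : pathExcess D s t u = 0 := by unfold pathExcess; rw [hst, h.self]; ring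
    rw [show pathMinExcess D s t u = 0 by linarith, zero_div]
    linarith
  · rcases lt_trichotomy t u with htu | htu | htu
    · rcases lt_trichotomy s u with hsu | hsu | hsu
      · have := key t s u hst hsu (by rw [h.pathExcess_reverse]; exact m3) (by linarith)
        linarith
      · have : pathExcess D t u s = 0 := by unfold pathExcess; rw [hsu, h.self]; ring
        rw [show pathMinExcess D s t u = 0 by linarith, zero_div]
        linarith
      · have := key t u s htu hsu m2 (by linarith)
        linarith
    · have : pathExcess D s t u = 0 := by unfold pathExcess; rw [htu, h.self]; ring
      rw [show pathMinExcess D s t u = 0 by linarith, zero_div]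
      linarith
    · have := key u t s htu hst (by rw [h.pathExcess_reverse]; exact m1) (by linarith)
      linarith

theorem sum_pathMinExcess_le (h : IsRegularPath C n D) :
    ∑ s ∈ Finset.range n, ∑ t ∈ Finset.range n, ∑ u ∈ Finset.range n,
      pathMinExcess D s t u / max |(s : ℝ) - t| |(s : ℝ) - u| ^ 3 ≤ 48 * n := by
  refine (Finset.sum_le_sum fun s _ => Finset.sum_le_sum fun t _ => Finset.sum_le_sum fun u _ =>
    h.pathMinExcess_div_le s t u).trans ?_
  have T := h.sum_ordered_excess_le
  set o : ℕ → ℕ → ℕ → ℝ := fun s t u =>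
    if s < t ∧ t < u then pathExcess D s t u / ((u : ℝ) - s) ^ 3 else 0 with ho
  change ∑ s ∈ Finset.range n, ∑ t ∈ Finset.range n, ∑ u ∈ Finset.range n, o s t u ≤ n at T
  change ∑ s ∈ Finset.range n, ∑ t ∈ Finset.range n, ∑ u ∈ Finset.range n,
    8 * (o s t u + o s u t + o t s u + o t u s + o u s t + o u t s) ≤ 48 * n
  have swap12 : ∀ f : ℕ → ℕ → ℕ → ℝ,
      ∑ s ∈ Finset.range n, ∑ t ∈ Finset.range n, ∑ u ∈ Finset.range n, f t s u =
      ∑ s ∈ Finset.range n, ∑ t ∈ Finset.range n, ∑ u ∈ Finset.range n, f s t u :=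
    fun f => Finset.sum_comm
  have swap23 : ∀ f : ℕ → ℕ → ℕ → ℝ,
      ∑ s ∈ Finset.range n, ∑ t ∈ Finset.range n, ∑ u ∈ Finset.range n, f s u t =
      ∑ s ∈ Finset.range n, ∑ t ∈ Finset.range n, ∑ u ∈ Finset.range n, f s t u :=
    fun f => Finset.sum_congr rfl fun s _ => Finset.sum_comm
  simp only [← Finset.mul_sum, Finset.sum_add_distrib]
  rw [swap23 (fun s t u => o s t u), swap12 (fun s t u => o s t u),
    swap12 (fun s t u => o s u t), swap23 (fun s t u => o s t u),
    swap23 (fun s t u => o t s u), swap12 (fun s t u => o s t u),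
    swap23 (fun s t u => o t u s), swap12 (fun s t u => o s u t), swap23 (fun s t u => o s t u)]
  linarith

/-- One triple of excess `η * 2 ^ k` yields of the order of `(η * 2 ^ k) ^ 3` neighbouring triples
of comparable excess. This makes a single bad triple visible in the telescoped sum. -/
theorem one_le_sum_excess_of_farExcess (h : IsRegularPath C n D) {η : ℝ} (hη : 0 < η) {s k : ℕ}
    (hf : FarExcess D n η s k) :
    1 ≤ 2048 / (η ^ 4 * (2 ^ k) ^ 4) * ∑ a ∈ Finset.range n, ∑ b ∈ Finset.range n,
      ∑ c ∈ Finset.range n, (if a < b ∧ b < c ∧ (c : ℝ) - a ≤ 2 * 2 ^ k ∧ D s a ≤ 3 * 2 ^ k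
        then pathExcess D a b c else 0) := by
  obtain ⟨a, b, c, hab, hbc, hcn, hca, hsa, he⟩ := hf
  set r : ℝ := 2 ^ k with hr
  have hr0 : 0 < r := by positivity
  -- Moving three parameters by at most `η * r / 8` costs at most `3 * η * r / 4` of excess, so `η *
  -- r / 4` survives.
  set p := ⌊η * r / 8⌋₊ with hp
  have hp1 : (p : ℝ) ≤ η * r / 8 := Nat.floor_le (by positivity)
  have hp2 : η * r / 8 < p + 1 := Nat.lt_floor_add_one _
  have l1 := h.pathExcess_le_two_mul_left a b c
  have l2 := h.dist_le_sub hab.le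
  have l3 := h.pathExcess_le_two_mul_right a b c
  have l4 := h.dist_le_sub hbc.le
  have hη0 : 0 < η * r := by positivity
  have hab' : a + 2 * p < b := by
    have : (a : ℝ) + 2 * p < b := by linarith
    exact_mod_cast this
  have hbc' : b + 2 * p < c := by
    have : (b : ℝ) + 2 * p < c := by linarith
    exact_mod_cast this
  set F : ℕ → ℕ → ℕ → ℝ := fun a b c =>
    if a < b ∧ b < c ∧ (c : ℝ) - a ≤ 2 * r ∧ D s a ≤ 3 * r then pathExcess D a b c else 0 with hF
  have hF0 : ∀ a b c, 0 ≤ F a b c := by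
    intro a b c
    simp only [hF]
    split_ifs
    · exact h.pathExcess_nonneg _ _ _
    · exact le_rfl
  -- The points `a` and `b` move forwards and `c` moves backwards, so the length does not grow; the
  -- gaps exceed `2 * p`, so the order is kept.
  have lower : ∀ i < p + 1, ∀ j < p + 1, ∀ l < p + 1,
      η * r / 4 ≤ F (a + i) (b + j) (c - p + l) := by
    intro i hi j hj l hl
    have hl' : c - p + l ≤ c := by omega
    have hi' : (i : ℝ) ≤ p := by exact_mod_cast Nat.lt_succ_iff.1 hi
    have hj' : (j : ℝ) ≤ p := by exact_mod_cast Nat.lt_succ_iff.1 hj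
    have d1 := h.dist_add_le a i
    have d2 := h.dist_add_le b j
    have d3 : D c (c - p + l) ≤ p := by
      rw [h.comm]
      refine (h.dist_le_sub hl').trans ?_
      have : (c : ℝ) ≤ p + (c - p + l : ℕ) := by exact_mod_cast (by omega : c ≤ p + (c - p + l))
      linarith
    have d4 := h.pathExcess_perturb a b c (a + i) (b + j) (c - p + l)
    have d5 := h.tri s a (a + i)
    have hl'' : ((c - p + l : ℕ) : ℝ) ≤ c := by exact_mod_cast hl'
    have i0 : (0 : ℝ) ≤ i := Nat.cast_nonneg i
    simp only [hF]
    rw [if_pos]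
    · linarith
    · refine ⟨by omega, by omega, ?_, ?_⟩
      · push_cast at hl'' ⊢
        linarith
      · linarith
  have hsum : ((p : ℝ) + 1) ^ 3 * (η * r / 4) ≤
      ∑ a ∈ Finset.range n, ∑ b ∈ Finset.range n, ∑ c ∈ Finset.range n, F a b c := by
    calc ((p : ℝ) + 1) ^ 3 * (η * r / 4)
        = ∑ i ∈ Finset.range (p + 1), ∑ j ∈ Finset.range (p + 1), ∑ l ∈ Finset.range (p + 1),
            (η * r / 4) := by
          simp only [Finset.sum_const, Finset.card_range, nsmul_eq_mul]
          push_cast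
          ring
      _ ≤ ∑ i ∈ Finset.range (p + 1), ∑ j ∈ Finset.range (p + 1), ∑ l ∈ Finset.range (p + 1),
            F (a + i) (b + j) (c - p + l) :=
          Finset.sum_le_sum fun i hi => Finset.sum_le_sum fun j hj => Finset.sum_le_sum fun l hl =>
            lower i (Finset.mem_range.1 hi) j (Finset.mem_range.1 hj) l (Finset.mem_range.1 hl)
      _ ≤ ∑ i ∈ Finset.range (p + 1), ∑ j ∈ Finset.range (p + 1), ∑ c ∈ Finset.range n,
            F (a + i) (b + j) c :=
          Finset.sum_le_sum fun i _ => Finset.sum_le_sum fun j _ =>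
            sum_range_shift_le (hF0 _ _) (by omega)
      _ ≤ ∑ i ∈ Finset.range (p + 1), ∑ b ∈ Finset.range n, ∑ c ∈ Finset.range n, F (a + i) b c :=
          Finset.sum_le_sum fun i _ => sum_range_shift_le
            (F := fun b => ∑ c ∈ Finset.range n, F (a + i) b c)
            (fun _ => Finset.sum_nonneg fun _ _ => hF0 _ _ _) (by omega)
      _ ≤ _ := sum_range_shift_le
            (F := fun a => ∑ b ∈ Finset.range n, ∑ c ∈ Finset.range n, F a b c)
            (fun _ => Finset.sum_nonneg fun _ _ => Finset.sum_nonneg fun _ _ => hF0 _ _ _)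
            (by omega)
  have hcube : (η * r / 8) ^ 3 * (η * r / 4) ≤ ((p : ℝ) + 1) ^ 3 * (η * r / 4) := by
    gcongr
  calc (1 : ℝ) = 2048 / (η ^ 4 * r ^ 4) * ((η * r / 8) ^ 3 * (η * r / 4)) := by
        field_simp
        norm_num
    _ ≤ _ := by
        gcongr
        exact hcube.trans hsum

open Classical in
-- A Carleson packing bound. After exchanging sums, a triple `a < b < c` is charged at scale `2 ^ k`
-- by at most `3 * C * 2 ^ k` parameters `s` with weight of order `2 ^ (-4 * k)`, and only if `c - a
-- ≤ 2 * 2 ^ k`. Summing over `k` leaves `excess / (c - a) ^ 3`, the telescoping sum.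
theorem sum_farExcess_le (h : IsRegularPath C n D) {η : ℝ} (hη : 0 < η) (hC : 0 ≤ C)
    (m : ℕ) :
    ∑ k ∈ Finset.range m, ∑ s ∈ Finset.range n, (if FarExcess D n η s k then (1 : ℝ) else 0)
      ≤ 98304 * C / η ^ 4 * n := by
  have step : ∀ k ∈ Finset.range m,
      ∑ s ∈ Finset.range n, (if FarExcess D n η s k then (1 : ℝ) else 0) ≤
      ∑ a ∈ Finset.range n, ∑ b ∈ Finset.range n, ∑ c ∈ Finset.range n,
        (6144 * C / η ^ 4) * (if a < b ∧ b < c then pathExcess D a b c *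
          (if ((c : ℝ) - a) / 2 ≤ 2 ^ k then 1 / ((2 : ℝ) ^ k) ^ 3 else 0) else 0) := by
    intro k _
    set r : ℝ := 2 ^ k with hr
    have hr1 : 1 ≤ r := one_le_pow₀ (by norm_num)
    have hr0 : 0 < r := by positivity
    calc ∑ s ∈ Finset.range n, (if FarExcess D n η s k then (1 : ℝ) else 0)
        ≤ ∑ s ∈ Finset.range n, 2048 / (η ^ 4 * r ^ 4) * ∑ a ∈ Finset.range n,
            ∑ b ∈ Finset.range n, ∑ c ∈ Finset.range n,
            (if a < b ∧ b < c ∧ (c : ℝ) - a ≤ 2 * r ∧ D s a ≤ 3 * r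
              then pathExcess D a b c else 0) := by
          refine Finset.sum_le_sum fun s _ => ?_
          split_ifs with hf
          · exact h.one_le_sum_excess_of_farExcess hη hf
          · refine mul_nonneg (by positivity) (Finset.sum_nonneg fun _ _ => Finset.sum_nonneg
              fun _ _ => Finset.sum_nonneg fun _ _ => ?_)
            split_ifs
            · exact h.pathExcess_nonneg _ _ _
            · exact le_rfl
      _ = ∑ a ∈ Finset.range n, ∑ b ∈ Finset.range n, ∑ c ∈ Finset.range n,
            ∑ s ∈ Finset.range n, 2048 / (η ^ 4 * r ^ 4) *
            (if a < b ∧ b < c ∧ (c : ℝ) - a ≤ 2 * r ∧ D s a ≤ 3 * r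
              then pathExcess D a b c else 0) := by
          simp only [Finset.mul_sum]
          rw [Finset.sum_comm]
          refine Finset.sum_congr rfl fun a _ => ?_
          rw [Finset.sum_comm]
          refine Finset.sum_congr rfl fun b _ => ?_
          rw [Finset.sum_comm]
      _ ≤ _ := by
          refine Finset.sum_le_sum fun a _ => Finset.sum_le_sum fun b _ =>
            Finset.sum_le_sum fun c _ => ?_
          by_cases habc : a < b ∧ b < c
          · rw [if_pos habc]
            by_cases hca : (c : ℝ) - a ≤ 2 * r
            · rw [if_pos (by linarith)]
              have hcard := h.card a (3 * r) (by linarith)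
              have e : ∑ s ∈ Finset.range n, 2048 / (η ^ 4 * r ^ 4) *
                  (if a < b ∧ b < c ∧ (c : ℝ) - a ≤ 2 * r ∧ D s a ≤ 3 * r
                    then pathExcess D a b c else 0)
                  = (((Finset.range n).filter fun t => D a t ≤ 3 * r).card : ℝ) *
                    (2048 / (η ^ 4 * r ^ 4) * pathExcess D a b c) := by
                rw [← nsmul_eq_mul, ← Finset.sum_const, Finset.sum_filter]
                refine Finset.sum_congr rfl fun s _ => ?_
                simp only [habc.1, habc.2, hca, true_and, h.comm s a]
                split_ifs <;> ring
              rw [e]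
              have hex := h.pathExcess_nonneg a b c
              calc _ ≤ C * (3 * r) * (2048 / (η ^ 4 * r ^ 4) * pathExcess D a b c) := by gcongr
                _ = _ := by field_simp; ring
            · rw [if_neg (by linarith)]
              simp [hca]
          · rw [if_neg habc]
            refine (Finset.sum_eq_zero fun s _ => ?_).trans_le (by simp)
            rw [if_neg (by tauto), mul_zero]
  calc _ ≤ _ := Finset.sum_le_sum step
    _ = 6144 * C / η ^ 4 * ∑ a ∈ Finset.range n, ∑ b ∈ Finset.range n, ∑ c ∈ Finset.range n,
        (if a < b ∧ b < c then pathExcess D a b c *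
          ∑ k ∈ Finset.range m,
          (if ((c : ℝ) - a) / 2 ≤ 2 ^ k then 1 / ((2 : ℝ) ^ k) ^ 3 else 0) else 0) := by
        simp only [Finset.mul_sum]
        rw [Finset.sum_comm]
        refine Finset.sum_congr rfl fun a _ => ?_
        rw [Finset.sum_comm]
        refine Finset.sum_congr rfl fun b _ => ?_
        rw [Finset.sum_comm]
        refine Finset.sum_congr rfl fun c _ => ?_
        split_ifs
        · rw [Finset.mul_sum]
        · simp
    _ ≤ 6144 * C / η ^ 4 * ∑ a ∈ Finset.range n, ∑ b ∈ Finset.range n, ∑ c ∈ Finset.range n,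
        16 * (if a < b ∧ b < c then pathExcess D a b c / ((c : ℝ) - a) ^ 3 else 0) := by
        gcongr with a _ b _ c _
        split_ifs with habc
        · have hac : (a : ℝ) < c := by exact_mod_cast habc.1.trans habc.2
          have hd : 0 < (c : ℝ) - a := by linarith
          have hex := h.pathExcess_nonneg a b c
          calc _ ≤ pathExcess D a b c * (2 / (((c : ℝ) - a) / 2) ^ 3) := by
                gcongr
                exact sum_dyadic_inv_cube_le (by linarith) m
            _ = _ := by field_simp; norm_num
        · simp
    _ ≤ 6144 * C / η ^ 4 * (16 * n) := by
        simp only [← Finset.mul_sum]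
        gcongr
        exact h.sum_ordered_excess_le
    _ = _ := by ring

end IsRegularPath

/-! ### Packing of jumps -/

theorem le_card_range_near {a q n : ℕ} (ha : a < n) (hq : q ≤ n) :
    q ≤ ((Finset.range n).filter fun t => t < a + q ∧ a < t + q).card := by
  -- Truncated subtraction moves the interval to start at `0` when `a` is near the left end; then `q
  -- ≤ n` keeps it in range.
  calc q = (Finset.Ico (a + 1 - q) (a + 1 - q + q)).card := by simp
    _ ≤ _ := by
      refine Finset.card_le_card fun t ht => ?_
      simp only [Finset.mem_Ico, Finset.mem_filter, Finset.mem_range] at ht ⊢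
      omega

/-- At distance at most `2 ^ k` from `s` there is a point of the path, such that the arc around it
of length comparable to `K * 2 ^ k` stays at distance more than `2 ^ (k - i)` from `s`. -/
def Jump (D : ℕ → ℕ → ℝ) (n : ℕ) (K : ℝ) (s k i : ℕ) : Prop :=
  ∃ t < n, D s t ≤ 2 ^ k ∧ ∀ t' < n, |(t : ℝ) - t'| ≤ K * 2 ^ k → (2 : ℝ) ^ k < 2 ^ i * D s t'

namespace IsRegularPath

variable {C : ℝ} {n : ℕ} {D : ℕ → ℕ → ℝ}

/-- The `c - a + 1` parameters of the arc cannot all lie in the ball of radius `(c - a) / C` about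
`a`, which holds at most `c - a`. For `b` outside it, the excess is at least `2 * (D a b - D a c)`.
-/
theorem exists_large_excess (h : IsRegularPath C n D) (hC : 1 ≤ C) {a c : ℕ} (hac : a < c)
    (hc : c < n) (hlong : C < (c : ℝ) - a) (hD : D a c ≤ ((c : ℝ) - a) / (2 * C)) :
    ∃ b, a < b ∧ b < c ∧ ((c : ℝ) - a) / C ≤ pathExcess D a b c := by
  have hC0 : 0 < C := by linarith
  obtain ⟨b, hb1, hb2, hb⟩ : ∃ b, a ≤ b ∧ b ≤ c ∧ ((c : ℝ) - a) / C < D a b := by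
    by_contra! hcon
    have h1 := h.card a (((c : ℝ) - a) / C) (by rw [le_div_iff₀ hC0]; linarith)
    rw [mul_div_cancel₀ _ hC0.ne'] at h1
    have h2 : c + 1 - a ≤ ((Finset.range n).filter fun t => D a t ≤ ((c : ℝ) - a) / C).card := by
      rw [← Nat.card_Ico]
      refine Finset.card_le_card fun t ht => ?_
      simp only [Finset.mem_Ico, Finset.mem_filter, Finset.mem_range] at ht ⊢
      exact ⟨by omega, hcon t ht.1 (by omega)⟩
    have h3 : ((c + 1 - a : ℕ) : ℝ) = (c : ℝ) + 1 - a := by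
      rw [Nat.cast_sub (by omega)]
      push_cast
      ring
    have h4 : ((c + 1 - a : ℕ) : ℝ) ≤ _ := Nat.cast_le.2 h2
    linarith
  have hpos : 0 < ((c : ℝ) - a) / C := by
    apply div_pos _ hC0
    linarith
  have e : ((c : ℝ) - a) / (2 * C) = ((c : ℝ) - a) / C / 2 := by field_simp
  rw [e] at hD
  refine ⟨b, lt_of_le_of_ne hb1 ?_, lt_of_le_of_ne hb2 ?_, ?_⟩
  · rintro rfl
    rw [h.self] at hb
    linarith
  · rintro rfl
    linarith
  · have := h.tri a c b
    rw [h.comm c b] at this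
    unfold pathExcess
    linarith

/-- Witnesses of jumps at two different scales belong to different arcs, unless there is a large
excess at an intermediate scale. -/
theorem jump_witness_far (h : IsRegularPath C n D) (hC : 1 ≤ C) {s i k k' m t t' : ℕ}
    (hkk : k + i < k')
    (hE : ∀ e, k' < e → e ≤ m → ¬ FarExcess D n (1 / (2 * C)) s e)
    (ht : t < n) (ht' : t' < n) (hst : D s t ≤ 2 ^ k) (hst' : D s t' ≤ 2 ^ k')
    (hfar : ∀ u < n, |(t' : ℝ) - u| ≤ 8 * C * 2 ^ k' → (2 : ℝ) ^ k' < 2 ^ i * D s u) :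
    (2 : ℝ) ^ m < |(t : ℝ) - t'| := by
  by_contra! hm
  have hC0 : 0 < C := by linarith
  have hk1 : (1 : ℝ) ≤ 2 ^ k' := one_le_pow₀ (by norm_num)
  have hk2 : (2 : ℝ) ^ k ≤ 2 ^ k' := pow_le_pow_right₀ (by norm_num) (by omega)
  -- If `t` were on the arc protected by the jump at `k'`, then `2 ^ k' < 2 ^ i * D s t ≤ 2 ^ (i +
  -- k)`, against `k + i < k'`.
  have hp : 8 * C * 2 ^ k' < |(t : ℝ) - t'| := by
    by_contra! hle
    have h1 := hfar t ht (by rwa [abs_sub_comm])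
    have h2 : (2 : ℝ) ^ i * D s t ≤ 2 ^ i * 2 ^ k := by gcongr
    rw [← pow_add] at h2
    have h3 : (2 : ℝ) ^ (i + k) ≤ 2 ^ k' := pow_le_pow_right₀ (by norm_num) (by omega)
    linarith
  -- Two parameters close to `s` but far apart along the path bound an arc with nearby ends, hence a
  -- triple of large excess at a scale excluded by `hE`.
  have main : ∀ a c : ℕ, a < c → c < n → D s a ≤ 2 ^ k' → D s c ≤ 2 ^ k' →
      8 * C * 2 ^ k' < (c : ℝ) - a → (c : ℝ) - a ≤ 2 ^ m → False := by
    intro a c hac hcn ha hc hlong hm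
    have hca : (c : ℝ) - a = (c - a : ℕ) := by rw [Nat.cast_sub hac.le]
    have hCk : C ≤ C * 2 ^ k' := le_mul_of_one_le_right hC0.le hk1
    have hk8 : (2 : ℝ) ^ k' ≤ C * 2 ^ k' := le_mul_of_one_le_left (by positivity) hC
    obtain ⟨b, hab, hbc, hb⟩ := h.exists_large_excess hC hac hcn (by linarith) (by
      have h1 := h.tri a s c
      rw [h.comm a s] at h1
      rw [le_div_iff₀ (by linarith)]
      calc D a c * (2 * C) ≤ (2 * 2 ^ k') * (2 * C) := by gcongr; linarith
        _ ≤ _ := by linarith)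
    -- The scale `e` satisfies `c - a ≤ 2 ^ e < 2 * (c - a)`, which matches the threshold `1 / (2 *
    -- C)` in `hE`.
    set e := Nat.clog 2 (c - a) with he
    have hle : (c : ℝ) - a ≤ 2 ^ e := by
      rw [hca]
      exact_mod_cast Nat.le_pow_clog (by norm_num) _
    have he1 : k' < e := by
      have : (2 : ℝ) ^ k' < 2 ^ e := by linarith
      exact (pow_lt_pow_iff_right₀ (by norm_num)).1 this
    have hem : e ≤ m := by
      rw [he]
      refine Nat.clog_le_of_le_pow ?_
      rw [hca] at hm
      exact_mod_cast hm
    have hlt : (2 : ℝ) ^ e < 2 * ((c : ℝ) - a) := by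
      have h1 : 1 < c - a := by
        have : (1 : ℝ) < (c - a : ℕ) := by rw [← hca]; linarith
        exact_mod_cast this
      have h2 := Nat.pow_pred_clog_lt_self (b := 2) (by norm_num) h1
      have h3 : (2 : ℝ) ^ (e - 1) < (c : ℝ) - a := by
        rw [hca]
        exact_mod_cast h2
      obtain ⟨e', he'⟩ : ∃ e', e = e' + 1 := ⟨e - 1, by omega⟩
      rw [he', Nat.add_sub_cancel] at h3
      rw [he', pow_succ]
      linarith
    have hke : (2 : ℝ) ^ k' ≤ 2 ^ e := pow_le_pow_right₀ (by norm_num) he1.le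
    refine hE e he1 hem ⟨a, b, c, hab, hbc, hcn, by linarith, by linarith, le_trans ?_ hb⟩
    rw [one_div_mul_eq_div, div_le_div_iff₀ (by linarith) hC0]
    nlinarith
  rcases lt_trichotomy t t' with htt | htt | htt
  · have htt' : (t : ℝ) < t' := by exact_mod_cast htt
    rw [abs_sub_comm, abs_of_pos (by linarith)] at hp hm
    exact main t t' htt ht' (by linarith) hst' hp hm
  · rw [htt, sub_self, abs_zero] at hp
    nlinarith
  · have htt' : (t' : ℝ) < t := by exact_mod_cast htt
    rw [abs_of_pos (by linarith)] at hp hm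
    exact main t' t htt ht hst' (by linarith) hp hm

/-- Only boundedly many widely separated jump scales fit between two scales of large excess. -/
theorem card_jumps_le (h : IsRegularPath C n D) (hC : 1 ≤ C) {s i : ℕ} {F : Finset ℕ}
    (hJ : ∀ k ∈ F, Jump D n (8 * C) s k i)
    (hsep : ∀ k ∈ F, ∀ k' ∈ F, k < k' → k + i < k')
    (hE : ∀ k ∈ F, ∀ k' ∈ F, ∀ e, k < e → e ≤ k' → ¬ FarExcess D n (1 / (2 * C)) s e) :
    (F.card : ℝ) ≤ 4 * C := by
  rcases Nat.lt_or_ge F.card 2 with hcard | hcard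
  · have : (F.card : ℝ) ≤ 1 := by exact_mod_cast Nat.lt_succ_iff.1 hcard
    linarith
  have hne : F.Nonempty := Finset.card_pos.1 (by omega)
  set m := F.max' hne with hm
  choose! t htn hst hfar using hJ
  have far : ∀ k ∈ F, ∀ k' ∈ F, k ≠ k' → (2 : ℝ) ^ m < |(t k : ℝ) - t k'| := by
    have lt : ∀ k ∈ F, ∀ k' ∈ F, k < k' → (2 : ℝ) ^ m < |(t k : ℝ) - t k'| := fun k hk k' hk' hkk =>
      h.jump_witness_far hC (hsep k hk k' hk' hkk)
        (fun e he1 he2 => hE k' hk' m (F.max'_mem hne) e he1 he2)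
        (htn k hk) (htn k' hk') (hst k hk) (hst k' hk') (hfar k' hk')
    intro k hk k' hk' hkk
    rcases lt_or_gt_of_ne hkk with hlt | hlt
    · exact lt k hk k' hk' hlt
    · rw [abs_sub_comm]
      exact lt k' hk' k hk hlt
  -- Intervals of parameters at distance less than `q`, that is at most `2 ^ m / 2`, from the
  -- witnesses are disjoint, since witnesses are more than `2 ^ m` apart. Each holds at least `q`
  -- parameters within `2 * 2 ^ m` of `s`.
  set q := 2 ^ m / 2 + 1 with hq
  have hm1 : 1 ≤ 2 ^ m := Nat.one_le_two_pow
  have far' : ∀ k ∈ F, ∀ k' ∈ F, k ≠ k' → 2 ^ m + t k < t k' ∨ 2 ^ m + t k' < t k := by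
    intro k hk k' hk' hkk
    rcases lt_abs.1 (far k hk k' hk' hkk) with h1 | h1
    · right
      have : (2 : ℝ) ^ m + t k' < t k := by linarith
      exact_mod_cast this
    · left
      have : (2 : ℝ) ^ m + t k < t k' := by linarith
      exact_mod_cast this
  have hqn : q ≤ n := by
    obtain ⟨k, hk, k', hk', hkk⟩ := Finset.one_lt_card.1 hcard
    have := far' k hk k' hk' hkk
    have := htn k hk
    have := htn k' hk'
    omega
  set I : ℕ → Finset ℕ := fun k =>
    (Finset.range n).filter fun u => u < t k + q ∧ t k < u + q with hI
  have hdisj : (F : Set ℕ).PairwiseDisjoint I := by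
    intro k hk k' hk' hkk
    refine Finset.disjoint_left.2 fun u hu hu' => ?_
    simp only [hI, Finset.mem_filter] at hu hu'
    have := far' k hk k' hk' hkk
    omega
  have hsub : F.biUnion I ⊆ (Finset.range n).filter fun u => D s u ≤ 2 * 2 ^ m := by
    intro u hu
    obtain ⟨k, hk, hu⟩ := Finset.mem_biUnion.1 hu
    simp only [hI, Finset.mem_filter] at hu ⊢
    refine ⟨hu.1, ?_⟩
    have h1 := h.tri s (t k) u
    have h2 := hst k hk
    have h3 : (2 : ℝ) ^ k ≤ 2 ^ m := pow_le_pow_right₀ (by norm_num) (F.le_max' k hk)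
    have h4 := h.dist_le_abs (t k) u
    have h5 : |(t k : ℝ) - u| ≤ 2 ^ m := by
      rw [abs_le]
      have l1 : u ≤ t k + 2 ^ m := by omega
      have l2 : t k ≤ u + 2 ^ m := by omega
      have l1' : (u : ℝ) ≤ t k + 2 ^ m := by exact_mod_cast l1
      have l2' : (t k : ℝ) ≤ u + 2 ^ m := by exact_mod_cast l2
      constructor <;> linarith
    linarith
  have hm1' : (1 : ℝ) ≤ 2 ^ m := one_le_pow₀ (by norm_num)
  have h1 : F.card * q ≤ (F.biUnion I).card := by
    rw [Finset.card_biUnion hdisj, ← smul_eq_mul]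
    exact Finset.card_nsmul_le_sum _ _ _ fun k hk => le_card_range_near (htn k hk) hqn
  have h2 : ((F.card * q : ℕ) : ℝ) ≤ C * (2 * 2 ^ m) :=
    (Nat.cast_le.2 (h1.trans (Finset.card_le_card hsub))).trans (h.card s _ (by linarith))
  have h3 : (2 : ℝ) ^ m / 2 ≤ q := by
    have : (2 : ℝ) ^ m ≤ 2 * q := by exact_mod_cast (by omega : 2 ^ m ≤ 2 * q)
    linarith
  have h4 : (F.card : ℝ) * (2 ^ m / 2) ≤ C * (2 * 2 ^ m) := by
    push_cast at h2
    exact le_trans (by gcongr) h2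
  have h5 : (F.card : ℝ) * 2 ^ m ≤ (4 * C) * 2 ^ m := by linarith
  exact le_of_mul_le_mul_right h5 (by linarith)

open Classical in
-- Jump scales are sorted by the number of scales of large excess up to them and by their residue
-- modulo `i + 1`. Within a class no large excess intervenes and distinct scales differ by more than
-- `i`, so `card_jumps_le` bounds each class.
theorem card_filter_jump_le (h : IsRegularPath C n D) (hC : 1 ≤ C) (s i m : ℕ) :
    (((Finset.range m).filter fun k => Jump D n (8 * C) s k i).card : ℝ) ≤
      4 * C * (i + 1) *
        (((Finset.range m).filter fun k => FarExcess D n (1 / (2 * C)) s k).card + 1) := by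
  set J := (Finset.range m).filter fun k => Jump D n (8 * C) s k i with hJ
  set E := (Finset.range m).filter fun k => FarExcess D n (1 / (2 * C)) s k with hE
  set f : ℕ → ℕ × ℕ := fun k => ((E.filter fun e => e ≤ k).card, k % (i + 1)) with hf
  have hfib := Finset.card_le_mul_card_image_of_maps_to (s := J) (f := f)
    (t := Finset.range (E.card + 1) ×ˢ Finset.range (i + 1)) (by
      intro k _
      simp only [hf, Finset.mem_product, Finset.mem_range]
      exact ⟨Nat.lt_succ_of_le (Finset.card_filter_le _ _), Nat.mod_lt _ (by omega)⟩)
    ⌊4 * C⌋₊ (by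
      intro b _
      rw [Nat.le_floor_iff (by linarith)]
      refine h.card_jumps_le hC (s := s) (i := i) ?_ ?_ ?_
      · intro k hk
        simp only [Finset.mem_filter, hJ] at hk
        exact hk.1.2
      · intro k hk k' hk' hkk
        simp only [Finset.mem_filter, hf] at hk hk'
        have hmod : k % (i + 1) = k' % (i + 1) := by
          have := congrArg Prod.snd (hk.2.trans hk'.2.symm)
          exact this
        have hdvd : i + 1 ∣ k' - k := (Nat.modEq_iff_dvd' hkk.le).1 hmod
        have := Nat.le_of_dvd (by omega) hdvd
        omega
      · intro k hk k' hk' e hke hek hfar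
        simp only [Finset.mem_filter, hf, hJ, Finset.mem_range] at hk hk'
        have hcard : (E.filter fun e => e ≤ k).card = (E.filter fun e => e ≤ k').card := by
          have := congrArg Prod.fst (hk.2.trans hk'.2.symm)
          exact this
        have hsub : (E.filter fun e => e ≤ k) ⊆ (E.filter fun e => e ≤ k') := by
          intro x hx
          simp only [Finset.mem_filter] at hx ⊢
          exact ⟨hx.1, by omega⟩
        have heq := Finset.eq_of_subset_of_card_le hsub hcard.ge
        have hmem : e ∈ E.filter fun e => e ≤ k' := by
          simp only [Finset.mem_filter, hE, Finset.mem_range]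
          exact ⟨⟨by omega, hfar⟩, hek⟩
        rw [← heq] at hmem
        have := (Finset.mem_filter.1 hmem).2
        omega)
  rw [Finset.card_product, Finset.card_range, Finset.card_range] at hfib
  calc (J.card : ℝ) ≤ (⌊4 * C⌋₊ * ((E.card + 1) * (i + 1)) : ℕ) := Nat.cast_le.2 hfib
    _ = ⌊4 * C⌋₊ * ((E.card + 1) * (i + 1)) := by push_cast; ring
    _ ≤ 4 * C * ((E.card + 1) * (i + 1)) := by
      gcongr
      exact Nat.floor_le (by linarith)
    _ = _ := by ring

open Classical in
-- The growth in `i` is only linear, so it is summable against the factor `2 ^ (-i)` in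
-- `jumpWeight`.
theorem sum_jump_le (h : IsRegularPath C n D) (hC : 1 ≤ C) (m i : ℕ) :
    ∑ k ∈ Finset.range m, ∑ s ∈ Finset.range n, (if Jump D n (8 * C) s k i then (1 : ℝ) else 0) ≤
      4 * C * (98304 * C / (1 / (2 * C)) ^ 4 + 1) * n * (i + 1) := by
  have hE := h.sum_farExcess_le (η := 1 / (2 * C)) (by positivity) (by linarith) m
  rw [Finset.sum_comm] at hE ⊢
  calc ∑ s ∈ Finset.range n, ∑ k ∈ Finset.range m,
        (if Jump D n (8 * C) s k i then (1 : ℝ) else 0)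
      ≤ ∑ s ∈ Finset.range n, 4 * C * (i + 1) * (∑ k ∈ Finset.range m,
        (if FarExcess D n (1 / (2 * C)) s k then (1 : ℝ) else 0) + 1) := by
        refine Finset.sum_le_sum fun s _ => ?_
        have := h.card_filter_jump_le hC s i m
        simpa only [Finset.card_filter, Nat.cast_sum, Nat.cast_ite, Nat.cast_one, Nat.cast_zero]
          using this
    _ = 4 * C * (i + 1) * (∑ s ∈ Finset.range n, ∑ k ∈ Finset.range m,
        (if FarExcess D n (1 / (2 * C)) s k then (1 : ℝ) else 0) + n) := by
        rw [← Finset.mul_sum, Finset.sum_add_distrib]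
        simp
    _ ≤ 4 * C * (i + 1) * (98304 * C / (1 / (2 * C)) ^ 4 * n + n) := by gcongr
    _ = _ := by ring

end IsRegularPath

/-! ### Splitting the excess into weights and summing over scales -/

theorem sum_range_inv_two_pow_le (m : ℕ) : ∑ k ∈ Finset.range m, 1 / (2 : ℝ) ^ k ≤ 2 := by
  have : ∀ m : ℕ, ∑ k ∈ Finset.range m, 1 / (2 : ℝ) ^ k = 2 - 2 / 2 ^ m := by
    intro m
    induction m with
    | zero => norm_num
    | succ m ih =>
      rw [Finset.sum_range_succ, ih]
      field_simp
      ring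
  rw [this]
  have : (0 : ℝ) ≤ 2 / 2 ^ m := by positivity
  linarith

theorem sum_range_succ_div_two_pow_le (m : ℕ) :
    ∑ i ∈ Finset.range m, ((i : ℝ) + 1) / 2 ^ i ≤ 4 := by
  have : ∀ m : ℕ, ∑ i ∈ Finset.range m, ((i : ℝ) + 1) / 2 ^ i = 4 - (2 * m + 4) / 2 ^ m := by
    intro m
    induction m with
    | zero => norm_num
    | succ m ih =>
      rw [Finset.sum_range_succ, ih]
      push_cast
      field_simp
      ring
  rw [this]
  have : (0 : ℝ) ≤ (2 * m + 4) / 2 ^ m := by positivity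
  linarith

/-- The total weight of the jumps at `s` and scale `2 ^ k`. -/
noncomputable def jumpWeight (D : ℕ → ℕ → ℝ) (n : ℕ) (K : ℝ) (s k : ℕ) : ℝ :=
  open Classical in
  ∑ i ∈ Finset.range (n + 2), 128 * 2 ^ k / 2 ^ i * (if Jump D n K s k i then (1 : ℝ) else 0)

/-- The contribution of the parameters `a`, `b` on the arc around `s` to a triple whose other two
points lie close to this arc. -/
noncomputable def arcWeight (D : ℕ → ℕ → ℝ) (L : ℝ) (s t u a b : ℕ) : ℝ :=
  open Classical in
  if |(s : ℝ) - a| ≤ L ∧ |(s : ℝ) - b| ≤ L ∧ 16 ≤ pathMinExcess D s a b ∧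
      D a t ≤ pathMinExcess D s a b / 16 ∧ D b u ≤ pathMinExcess D s a b / 16
    then 20000 / pathMinExcess D s a b else 0

namespace IsRegularPath

variable {C : ℝ} {n : ℕ} {D : ℕ → ℕ → ℝ}

theorem jumpWeight_nonneg (K : ℝ) (s k : ℕ) : 0 ≤ jumpWeight D n K s k := by
  unfold jumpWeight
  exact Finset.sum_nonneg fun i _ => by positivity

theorem arcWeight_nonneg (h : IsRegularPath C n D) (L : ℝ) (s t u a b : ℕ) :
    0 ≤ arcWeight D L s t u a b := by
  unfold arcWeight
  have := h.pathMinExcess_nonneg s a b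
  split_ifs <;> positivity

/-- The point `s` itself witnesses a jump at `t`, as the arc around it keeps distance `m / 64` from
`t`. -/
theorem le_jumpWeight (h : IsRegularPath C n D) {s t k : ℕ} {m : ℝ} (hs : s < n)
    (hk : k ≤ n) (hst : D t s ≤ 2 ^ k) (hm : 64 ≤ m) (hmk : m ≤ 2 ^ k)
    (hfar : ∀ a < n, |(s : ℝ) - a| ≤ 8 * C * 2 ^ k → m / 64 < D a t) :
    m ≤ jumpWeight D n (8 * C) t k := by
  classical
  have hm0 : 0 < m := by linarith
  -- The jump has index `j + 1`: `2 ^ (j + 1) * (m / 64) > 2 ^ k` makes the arc avoid the ball,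
  -- while `2 ^ j ≤ 64 * 2 ^ k / m` makes its weight at least `m`.
  obtain ⟨j, hj1, hj2⟩ := exists_nat_pow_near (x := 64 * 2 ^ k / m) (y := (2 : ℝ))
    (by rw [le_div_iff₀ hm0]; linarith) (by norm_num)
  rw [div_lt_iff₀ hm0] at hj2
  rw [le_div_iff₀ hm0] at hj1
  have hjk : j ≤ k := by
    have : (2 : ℝ) ^ j ≤ 2 ^ k := by
      have : (2 : ℝ) ^ j * 64 ≤ 2 ^ j * m := by gcongr
      linarith
    exact (pow_le_pow_iff_right₀ (by norm_num)).1 this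
  have hjump : Jump D n (8 * C) t k (j + 1) := by
    refine ⟨s, hs, hst, fun a ha hsa => ?_⟩
    have h1 := hfar a ha hsa
    rw [h.comm a t] at h1
    have : (2 : ℝ) ^ (j + 1) * (m / 64) < 2 ^ (j + 1) * D t a := by gcongr
    linarith
  unfold jumpWeight
  refine le_trans ?_ (Finset.single_le_sum (f := fun i => 128 * (2 : ℝ) ^ k / 2 ^ i *
    (if Jump D n (8 * C) t k i then (1 : ℝ) else 0)) (fun i _ => by positivity)
    (Finset.mem_range.2 (by omega : j + 1 < n + 2)))
  rw [if_pos hjump, mul_one, le_div_iff₀ (by positivity), pow_succ]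
  linarith

/-- Sliding `a` and `b` along the path by less than `m / 64` yields at least `(m / 128) ^ 2`
admissible pairs, each of weight at least `128 ^ 2 / m`. -/
theorem le_sum_arcWeight (h : IsRegularPath C n D) (hC : 1 ≤ C) {s t u k a b : ℕ}
    (hs : s < n) (ht : t < n) (ha : a < n) (hb : b < n)
    (hm : 64 ≤ pathMinExcess D s t u) (hmk : pathMinExcess D s t u ≤ 2 ^ k)
    (hsa : |(s : ℝ) - a| ≤ 8 * C * 2 ^ k) (hsb : |(s : ℝ) - b| ≤ 8 * C * 2 ^ k)
    (hat : D a t ≤ pathMinExcess D s t u / 64) (hbu : D b u ≤ pathMinExcess D s t u / 64) :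
    pathMinExcess D s t u ≤ ∑ a ∈ Finset.range n, ∑ b ∈ Finset.range n,
      arcWeight D (9 * C * 2 ^ k) s t u a b := by
  set m := pathMinExcess D s t u with hmdef
  set q := ⌊m / 64⌋₊ with hq
  have hm0 : 0 < m := by linarith
  have hq1 : (q : ℝ) ≤ m / 64 := Nat.floor_le (by positivity)
  have hq2 : m / 64 < q + 1 := Nat.lt_floor_add_one _
  have hq3 : 1 ≤ q := by
    rw [hq, Nat.one_le_floor_iff]
    linarith
  have hq3' : (1 : ℝ) ≤ q := by exact_mod_cast hq3
  have hqn : q ≤ n := by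
    have h1 : m ≤ pathExcess D s t u := min_le_left _ _
    have h2 := h.pathExcess_le_two_mul_left s t u
    have h3 := h.dist_le_abs s t
    have h4 : |(s : ℝ) - t| ≤ n := by
      have : (s : ℝ) < n := by exact_mod_cast hs
      have : (t : ℝ) < n := by exact_mod_cast ht
      have : (0 : ℝ) ≤ s := Nat.cast_nonneg s
      have : (0 : ℝ) ≤ t := Nat.cast_nonneg t
      rw [abs_le]
      constructor <;> linarith
    have : (q : ℝ) ≤ n := by linarith
    exact_mod_cast this
  set N : ℕ → Finset ℕ := fun a => (Finset.range n).filter fun x => x < a + q ∧ a < x + q with hN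
  have hNa := le_card_range_near ha hqn
  have hNb := le_card_range_near hb hqn
  have near : ∀ {x y : ℕ}, x ∈ N y → |(y : ℝ) - x| ≤ m / 64 := by
    intro x y hx
    simp only [hN, Finset.mem_filter] at hx
    have h1 : (x : ℝ) < y + q := by exact_mod_cast hx.2.1
    have h2 : (y : ℝ) < x + q := by exact_mod_cast hx.2.2
    rw [abs_le]
    constructor <;> linarith
  have hCr : (2 : ℝ) ^ k ≤ C * 2 ^ k := le_mul_of_one_le_left (by positivity) hC
  -- Here `D x t` and `D y u` are at most `m / 32`, so the minimal excess of `s`, `x`, `y` lies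
  -- between `7 * m / 8` and `9 * m / 8`; the `20000` leaves room for this distortion.
  have value : ∀ x ∈ N a, ∀ y ∈ N b, 16384 / m ≤ arcWeight D (9 * C * 2 ^ k) s t u x y := by
    intro x hx y hy
    have d1 := near hx
    have d2 := near hy
    have e1 := (h.dist_le_abs a x).trans d1
    have e2 := (h.dist_le_abs b y).trans d2
    have e3 := h.tri x a t
    have e4 := h.tri y b u
    rw [h.comm x a] at e3
    rw [h.comm y b] at e4
    have p1 := h.pathMinExcess_perturb s t u s x y
    have p2 := h.pathMinExcess_perturb s x y s t u
    rw [h.self, h.comm t x, h.comm u y] at p1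
    rw [h.self] at p2
    rw [← hmdef] at p1 p2
    have s1 := abs_sub_le (s : ℝ) a x
    have s2 := abs_sub_le (s : ℝ) b y
    unfold arcWeight
    rw [if_pos]
    · rw [div_le_div_iff₀ hm0 (by linarith)]
      linarith
    · refine ⟨?_, ?_, ?_, ?_, ?_⟩ <;> linarith
  calc m ≤ (q : ℝ) * (q * (16384 / m)) := by
        have : m / 128 ≤ q := by linarith
        calc m = m / 128 * (m / 128 * (16384 / m)) := by field_simp; norm_num
          _ ≤ _ := by gcongr
    _ ≤ (N a).card * ((N b).card * (16384 / m)) := by gcongr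
    _ = ∑ x ∈ N a, ∑ y ∈ N b, 16384 / m := by simp
    _ ≤ ∑ x ∈ N a, ∑ y ∈ N b, arcWeight D (9 * C * 2 ^ k) s t u x y :=
        Finset.sum_le_sum fun x hx => Finset.sum_le_sum fun y hy => value x hx y hy
    _ ≤ ∑ x ∈ N a, ∑ y ∈ Finset.range n, arcWeight D (9 * C * 2 ^ k) s t u x y :=
        Finset.sum_le_sum fun x _ => Finset.sum_le_sum_of_subset_of_nonneg
          (Finset.filter_subset _ _) fun _ _ _ => h.arcWeight_nonneg _ _ _ _ _ _
    _ ≤ _ := Finset.sum_le_sum_of_subset_of_nonneg (Finset.filter_subset _ _)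
          fun _ _ _ => Finset.sum_nonneg fun _ _ => h.arcWeight_nonneg _ _ _ _ _ _

/-- Either the excess is small, or one of the last two points is far from the arc around the first,
or the excess is comparable to that of triples on this arc. -/
theorem pathMinExcess_le_weights (h : IsRegularPath C n D) (hC : 1 ≤ C) {s t u k : ℕ}
    (hs : s < n) (ht : t < n) (hk : k ≤ n) (hd : pathDiam D s t u ≤ 2 ^ k) :
    pathMinExcess D s t u ≤ 64 + jumpWeight D n (8 * C) t k + jumpWeight D n (8 * C) u k
      + ∑ a ∈ Finset.range n, ∑ b ∈ Finset.range n, arcWeight D (9 * C * 2 ^ k) s t u a b := by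
  have j1 := jumpWeight_nonneg (D := D) (n := n) (8 * C) t k
  have j2 := jumpWeight_nonneg (D := D) (n := n) (8 * C) u k
  have g : 0 ≤ ∑ a ∈ Finset.range n, ∑ b ∈ Finset.range n,
      arcWeight D (9 * C * 2 ^ k) s t u a b :=
    Finset.sum_nonneg fun _ _ => Finset.sum_nonneg fun _ _ => h.arcWeight_nonneg _ _ _ _ _ _
  have hmk := (h.pathMinExcess_le_pathDiam s t u).trans hd
  have hst : D s t ≤ 2 ^ k := (le_max_left _ _).trans hd
  have hsu : D s u ≤ 2 ^ k := ((le_max_right _ _).trans (le_max_right _ _)).trans hd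
  rcases le_total (pathMinExcess D s t u) 64 with hm | hm
  · linarith
  by_cases h1 : ∀ a < n, |(s : ℝ) - a| ≤ 8 * C * 2 ^ k → pathMinExcess D s t u / 64 < D a t
  · have := h.le_jumpWeight hs hk (by rwa [h.comm]) hm hmk h1
    linarith
  by_cases h2 : ∀ a < n, |(s : ℝ) - a| ≤ 8 * C * 2 ^ k → pathMinExcess D s t u / 64 < D a u
  · have := h.le_jumpWeight hs hk (by rwa [h.comm]) hm hmk h2
    linarith
  push Not at h1 h2
  obtain ⟨a, ha, hsa, hat⟩ := h1
  obtain ⟨b, hb, hsb, hbu⟩ := h2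
  have := h.le_sum_arcWeight hC hs ht ha hb hm hmk hsa hsb hat hbu
  linarith

theorem sum_near_pairs_le (h : IsRegularPath C n D) (hC : 0 ≤ C) {r : ℝ} (hr : 1 ≤ r) {W : ℕ → ℝ}
    (hW : ∀ s, 0 ≤ W s) :
    ∑ s ∈ Finset.range n, ∑ t ∈ Finset.range n, ∑ u ∈ Finset.range n,
      (if D s t ≤ r ∧ D s u ≤ r then W s else 0) ≤ (C * r) ^ 2 * ∑ s ∈ Finset.range n, W s := by
  rw [Finset.mul_sum]
  refine Finset.sum_le_sum fun s _ => ?_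
  have hcard := h.card s r hr
  set N : ℝ := (((Finset.range n).filter fun t => D s t ≤ r).card : ℝ) with hN
  have e : ∑ t ∈ Finset.range n, ∑ u ∈ Finset.range n,
      (if D s t ≤ r ∧ D s u ≤ r then W s else 0) = N * (N * W s) := by
    have : ∀ x : ℝ, ∑ t ∈ Finset.range n, (if D s t ≤ r then x else 0) = N * x := by
      intro x
      rw [← Finset.sum_filter, Finset.sum_const, nsmul_eq_mul]
    rw [← this (N * W s)]
    refine Finset.sum_congr rfl fun t _ => ?_
    by_cases hst : D s t ≤ r
    · simp only [hst, true_and, if_true]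
      exact this (W s)
    · simp [hst]
  rw [e, sq, mul_assoc]
  have := hW s
  have : 0 ≤ N := Nat.cast_nonneg _
  gcongr

/-- By regularity at most `(C * m / 16) ^ 2` pairs `t`, `u` are charged to `a`, `b`, where `m` is
the minimal excess of `s`, `a`, `b`; each has weight `20000 / m`. The total is proportional to `m`,
for a triple whose parameter gaps are controlled by `L`. -/
theorem sum_arcWeight_le (h : IsRegularPath C n D) (hC : 0 ≤ C) (L : ℝ) (s a b : ℕ) :
    ∑ t ∈ Finset.range n, ∑ u ∈ Finset.range n, arcWeight D L s t u a b ≤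
      80 * C ^ 2 * (if max |(s : ℝ) - a| |(s : ℝ) - b| ≤ L then pathMinExcess D s a b else 0) := by
  classical
  have hm0 := h.pathMinExcess_nonneg s a b
  set m := pathMinExcess D s a b with hm
  by_cases hc : |(s : ℝ) - a| ≤ L ∧ |(s : ℝ) - b| ≤ L ∧ 16 ≤ m
  · rw [if_pos (max_le hc.1 hc.2.1)]
    have hm1 : 0 < m := by linarith [hc.2.2]
    have c1 := h.card a (m / 16) (by linarith [hc.2.2])
    have c2 := h.card b (m / 16) (by linarith [hc.2.2])
    have e : ∑ t ∈ Finset.range n, ∑ u ∈ Finset.range n, arcWeight D L s t u a b =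
        (((Finset.range n).filter fun t => D a t ≤ m / 16).card : ℝ) *
        ((((Finset.range n).filter fun t => D b t ≤ m / 16).card : ℝ) * (20000 / m)) := by
      rw [← nsmul_eq_mul, ← nsmul_eq_mul, ← Finset.sum_const, ← Finset.sum_const, Finset.sum_filter]
      refine Finset.sum_congr rfl fun t _ => ?_
      rw [Finset.sum_filter]
      unfold arcWeight
      rw [← hm]
      by_cases hat : D a t ≤ m / 16
      · simp [hc.1, hc.2.1, hc.2.2, hat]
      · simp [hat]
    rw [e]
    calc _ ≤ C * (m / 16) * (C * (m / 16) * (20000 / m)) := by gcongr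
      _ = C ^ 2 * m * (20000 / 256) := by field_simp; norm_num
      _ ≤ C ^ 2 * m * 80 := by gcongr; norm_num
      _ = _ := by ring
  · have : ∑ t ∈ Finset.range n, ∑ u ∈ Finset.range n, arcWeight D L s t u a b = 0 := by
      refine Finset.sum_eq_zero fun t _ => Finset.sum_eq_zero fun u _ => ?_
      unfold arcWeight
      rw [if_neg (by tauto)]
    rw [this]
    split_ifs <;> positivity

end IsRegularPath

namespace IsRegularPath

variable {C : ℝ} {n : ℕ} {D : ℕ → ℕ → ℝ}

theorem exists_scale (h : IsRegularPath C n D) {s t u : ℕ} (hs : s < n) (ht : t < n) (hu : u < n)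
    (hd : pathDiam D s t u ≠ 0) :
    ∃ k ≤ n, pathDiam D s t u ≤ 2 ^ k ∧ 2 ^ k ≤ 2 * pathDiam D s t u := by
  have hdn : pathDiam D s t u ≤ 2 ^ n := by
    have hn : ((n : ℕ) : ℝ) ≤ 2 ^ n := by exact_mod_cast Nat.lt_two_pow_self.le
    have key : ∀ x y : ℕ, x < n → y < n → D x y ≤ 2 ^ n := by
      intro x y hx hy
      refine (h.dist_le_abs x y).trans (le_trans ?_ hn)
      have : (x : ℝ) < n := by exact_mod_cast hx
      have : (y : ℝ) < n := by exact_mod_cast hy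
      have : (0 : ℝ) ≤ x := Nat.cast_nonneg x
      have : (0 : ℝ) ≤ y := Nat.cast_nonneg y
      rw [abs_le]
      constructor <;> linarith
    exact max_le (key s t hs ht) (max_le (key t u ht hu) (key s u hs hu))
  -- Separation excludes diameters strictly between `0` and `1 / 2`, so no scale below `2 ^ 0` is
  -- needed.
  have hhalf : 1 / 2 ≤ pathDiam D s t u := by
    by_contra! hlt
    have key : ∀ x y : ℕ, D x y ≤ pathDiam D s t u → D x y = 0 := by
      intro x y hxy
      rcases h.sep x y with h0 | h0
      · exact h0
      · linarith
    apply hd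
    unfold pathDiam
    rw [key s t (le_max_left _ _), key t u ((le_max_left _ _).trans (le_max_right _ _)),
      key s u ((le_max_right _ _).trans (le_max_right _ _))]
    simp
  classical
  have hex : ∃ k, pathDiam D s t u ≤ 2 ^ k := ⟨n, hdn⟩
  refine ⟨Nat.find hex, Nat.find_min' hex hdn, Nat.find_spec hex, ?_⟩
  rcases Nat.eq_zero_or_pos (Nat.find hex) with h0 | h0
  · rw [h0, pow_zero]
    linarith
  · have := Nat.find_min hex (Nat.sub_one_lt_of_lt h0)
    obtain ⟨j, hj⟩ : ∃ j, Nat.find hex = j + 1 := ⟨Nat.find hex - 1, by omega⟩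
    rw [hj, Nat.add_sub_cancel] at this
    rw [hj, pow_succ]
    linarith

/-- Only the scale comparable to the diameter is needed; adding the other nonnegative terms frees
`k` from the triple, so that sums can be exchanged. -/
theorem pathMinExcess_div_le_sum_scales (h : IsRegularPath C n D) (hC : 1 ≤ C) {s t u : ℕ}
    (hs : s < n) (ht : t < n) (hu : u < n) :
    pathMinExcess D s t u / pathDiam D s t u ^ 3 ≤ ∑ k ∈ Finset.range (n + 1),
      ((if D s t ≤ 2 ^ k ∧ D s u ≤ 2 ^ k then 512 / ((2 : ℝ) ^ k) ^ 3 else 0)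
      + (if D t s ≤ 2 ^ k ∧ D t u ≤ 2 ^ k
          then 8 / ((2 : ℝ) ^ k) ^ 3 * jumpWeight D n (8 * C) t k else 0)
      + (if D u s ≤ 2 ^ k ∧ D u t ≤ 2 ^ k
          then 8 / ((2 : ℝ) ^ k) ^ 3 * jumpWeight D n (8 * C) u k else 0)
      + 8 / ((2 : ℝ) ^ k) ^ 3 * ∑ a ∈ Finset.range n, ∑ b ∈ Finset.range n,
          arcWeight D (9 * C * 2 ^ k) s t u a b) := by
  have j := jumpWeight_nonneg (D := D) (n := n) (8 * C)
  have g : ∀ k : ℕ, 0 ≤ ∑ a ∈ Finset.range n, ∑ b ∈ Finset.range n,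
      arcWeight D (9 * C * 2 ^ k) s t u a b := fun k =>
    Finset.sum_nonneg fun _ _ => Finset.sum_nonneg fun _ _ => h.arcWeight_nonneg _ _ _ _ _ _
  have nonneg : ∀ k ∈ Finset.range (n + 1), 0 ≤
      ((if D s t ≤ 2 ^ k ∧ D s u ≤ 2 ^ k then 512 / ((2 : ℝ) ^ k) ^ 3 else 0)
      + (if D t s ≤ 2 ^ k ∧ D t u ≤ 2 ^ k
          then 8 / ((2 : ℝ) ^ k) ^ 3 * jumpWeight D n (8 * C) t k else 0)
      + (if D u s ≤ 2 ^ k ∧ D u t ≤ 2 ^ k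
          then 8 / ((2 : ℝ) ^ k) ^ 3 * jumpWeight D n (8 * C) u k else 0)
      + 8 / ((2 : ℝ) ^ k) ^ 3 * ∑ a ∈ Finset.range n, ∑ b ∈ Finset.range n,
          arcWeight D (9 * C * 2 ^ k) s t u a b) := by
    intro k _
    have := j t k
    have := j u k
    have := g k
    refine add_nonneg (add_nonneg (add_nonneg ?_ ?_) ?_) ?_ <;> try split_ifs
    all_goals positivity
  by_cases hd : pathDiam D s t u = 0
  · rw [hd]
    simpa using Finset.sum_nonneg nonneg
  obtain ⟨k, hk, hk1, hk2⟩ := h.exists_scale hs ht hu hd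
  refine le_trans ?_ (Finset.single_le_sum nonneg (Finset.mem_range.2 (by omega : k < n + 1)))
  have hst : D s t ≤ 2 ^ k := (le_max_left _ _).trans hk1
  have htu : D t u ≤ 2 ^ k := ((le_max_left _ _).trans (le_max_right _ _)).trans hk1
  have hsu : D s u ≤ 2 ^ k := ((le_max_right _ _).trans (le_max_right _ _)).trans hk1
  have hw := h.pathMinExcess_le_weights hC hs ht hk hk1
  rw [h.comm t s, h.comm u s, h.comm u t]
  simp only [hst, htu, hsu, and_self, if_true]
  have hm0 := h.pathMinExcess_nonneg s t u
  set r : ℝ := 2 ^ k with hr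
  have hr0 : 0 < r := by positivity
  calc pathMinExcess D s t u / pathDiam D s t u ^ 3 ≤ pathMinExcess D s t u / (r / 2) ^ 3 := by
        gcongr
        linarith
    _ = 8 / r ^ 3 * pathMinExcess D s t u := by field_simp; norm_num
    _ ≤ 8 / r ^ 3 * (64 + jumpWeight D n (8 * C) t k + jumpWeight D n (8 * C) u k
      + ∑ a ∈ Finset.range n, ∑ b ∈ Finset.range n, arcWeight D (9 * C * r) s t u a b) := by
        gcongr
    _ = _ := by ring

theorem sum_small_le (h : IsRegularPath C n D) (hC : 0 ≤ C) (m : ℕ) :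
    ∑ k ∈ Finset.range m, ∑ s ∈ Finset.range n, ∑ t ∈ Finset.range n, ∑ u ∈ Finset.range n,
      (if D s t ≤ 2 ^ k ∧ D s u ≤ 2 ^ k then 512 / ((2 : ℝ) ^ k) ^ 3 else 0)
      ≤ 1024 * C ^ 2 * n := by
  calc _ ≤ ∑ k ∈ Finset.range m, 512 * C ^ 2 * n * (1 / (2 : ℝ) ^ k) := by
        refine Finset.sum_le_sum fun k _ => ?_
        refine (h.sum_near_pairs_le hC (one_le_pow₀ (by norm_num)) (W := fun _ => 512 / (2 ^ k) ^ 3)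
          (fun _ => by positivity)).trans_eq ?_
        simp only [Finset.sum_const, Finset.card_range, nsmul_eq_mul]
        field_simp
    _ ≤ 512 * C ^ 2 * n * 2 := by
        rw [← Finset.mul_sum]
        gcongr
        exact sum_range_inv_two_pow_le m
    _ = _ := by ring

/-- At scale `2 ^ k`, the `(C * 2 ^ k) ^ 2` pairs near `s`, the factor `2 ^ (-3 * k)` and the weight
`2 ^ k / 2 ^ i` cancel to `2 ^ (-i)`. Without decay in `k`, the packing bound `sum_jump_le` is
indispensable. -/
theorem sum_jumpWeight_le (h : IsRegularPath C n D) (hC : 1 ≤ C) (m : ℕ) :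
    ∑ k ∈ Finset.range m, ∑ s ∈ Finset.range n, ∑ t ∈ Finset.range n, ∑ u ∈ Finset.range n,
      (if D s t ≤ 2 ^ k ∧ D s u ≤ 2 ^ k
          then 8 / ((2 : ℝ) ^ k) ^ 3 * jumpWeight D n (8 * C) s k else 0)
      ≤ 4096 * C ^ 2 * (4 * C * (98304 * C / (1 / (2 * C)) ^ 4 + 1)) * n := by
  classical
  set B := 4 * C * (98304 * C / (1 / (2 * C)) ^ 4 + 1) with hB
  have hB0 : 0 ≤ B := by positivity
  calc _ ≤ ∑ k ∈ Finset.range m, 1024 * C ^ 2 * ∑ i ∈ Finset.range (n + 2), 1 / 2 ^ i *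
          ∑ s ∈ Finset.range n, (if Jump D n (8 * C) s k i then (1 : ℝ) else 0) := by
        refine Finset.sum_le_sum fun k _ => ?_
        refine (h.sum_near_pairs_le (by linarith) (one_le_pow₀ (by norm_num))
          (W := fun s => 8 / (2 ^ k) ^ 3 * jumpWeight D n (8 * C) s k)
          (fun s => mul_nonneg (by positivity) (jumpWeight_nonneg _ _ _))).trans_eq ?_
        unfold jumpWeight
        simp only [Finset.mul_sum]
        rw [Finset.sum_comm]
        refine Finset.sum_congr rfl fun i _ => Finset.sum_congr rfl fun s _ => ?_
        field_simp
        norm_num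
    _ = 1024 * C ^ 2 * ∑ i ∈ Finset.range (n + 2), 1 / 2 ^ i * ∑ k ∈ Finset.range m,
          ∑ s ∈ Finset.range n, (if Jump D n (8 * C) s k i then (1 : ℝ) else 0) := by
        rw [← Finset.mul_sum, Finset.sum_comm]
        simp only [Finset.mul_sum]
    _ ≤ 1024 * C ^ 2 * ∑ i ∈ Finset.range (n + 2), 1 / 2 ^ i * (B * n * (i + 1)) := by
        gcongr with i _
        exact h.sum_jump_le hC m i
    _ = 1024 * C ^ 2 * (B * n) * ∑ i ∈ Finset.range (n + 2), ((i : ℝ) + 1) / 2 ^ i := by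
        simp only [Finset.mul_sum]
        refine Finset.sum_congr rfl fun i _ => ?_
        ring
    _ ≤ 1024 * C ^ 2 * (B * n) * 4 := by
        gcongr
        exact sum_range_succ_div_two_pow_le _
    _ = _ := by ring

/-- Summing over `t`, `u` first and then over the scales `2 ^ k` at least the maximal parameter gap
over `9 * C` brings the sum back to `sum_pathMinExcess_le`, where diameters are measured in the
parameter. -/
theorem sum_arcs_le (h : IsRegularPath C n D) (hC : 1 ≤ C) (m : ℕ) :
    ∑ k ∈ Finset.range m, ∑ s ∈ Finset.range n, ∑ t ∈ Finset.range n, ∑ u ∈ Finset.range n,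
      8 / ((2 : ℝ) ^ k) ^ 3 * ∑ a ∈ Finset.range n, ∑ b ∈ Finset.range n,
          arcWeight D (9 * C * 2 ^ k) s t u a b
      ≤ 44789760 * C ^ 5 * n := by
  have hC0 : 0 < C := by linarith
  have inner : ∀ k s : ℕ, ∑ t ∈ Finset.range n, ∑ u ∈ Finset.range n,
      8 / ((2 : ℝ) ^ k) ^ 3 * ∑ a ∈ Finset.range n, ∑ b ∈ Finset.range n,
          arcWeight D (9 * C * 2 ^ k) s t u a b ≤
      ∑ a ∈ Finset.range n, ∑ b ∈ Finset.range n, 640 * C ^ 2 * (pathMinExcess D s a b *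
        (if max |(s : ℝ) - a| |(s : ℝ) - b| / (9 * C) ≤ 2 ^ k then 1 / ((2 : ℝ) ^ k) ^ 3
          else 0)) := by
    intro k s
    calc _ = ∑ a ∈ Finset.range n, ∑ b ∈ Finset.range n, 8 / ((2 : ℝ) ^ k) ^ 3 *
          ∑ t ∈ Finset.range n, ∑ u ∈ Finset.range n, arcWeight D (9 * C * 2 ^ k) s t u a b := by
          simp only [Finset.mul_sum]
          simp only [Finset.sum_sigma']
          refine Finset.sum_nbij' (fun p => ⟨p.2.2.1, p.2.2.2, p.1, p.2.1⟩)
            (fun p => ⟨p.2.2.1, p.2.2.2, p.1, p.2.1⟩) ?_ ?_ ?_ ?_ ?_ <;>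
            rintro ⟨x, y, z, w⟩ hp <;>
            simp only [Finset.mem_sigma, Finset.mem_range] at hp ⊢ <;> tauto
      _ ≤ _ := by
          refine Finset.sum_le_sum fun a _ => Finset.sum_le_sum fun b _ => ?_
          refine (mul_le_mul_of_nonneg_left (h.sum_arcWeight_le hC0.le _ s a b)
            (by positivity)).trans_eq ?_
          have : max |(s : ℝ) - a| |(s : ℝ) - b| ≤ 9 * C * 2 ^ k ↔
              max |(s : ℝ) - a| |(s : ℝ) - b| / (9 * C) ≤ 2 ^ k := by
            rw [div_le_iff₀ (by linarith), mul_comm]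
          simp only [this]
          split_ifs
          · field_simp
            ring
          · simp
  calc _ ≤ ∑ k ∈ Finset.range m, ∑ s ∈ Finset.range n, ∑ a ∈ Finset.range n,
          ∑ b ∈ Finset.range n, 640 * C ^ 2 * (pathMinExcess D s a b *
        (if max |(s : ℝ) - a| |(s : ℝ) - b| / (9 * C) ≤ 2 ^ k then 1 / ((2 : ℝ) ^ k) ^ 3
          else 0)) := Finset.sum_le_sum fun k _ => Finset.sum_le_sum fun s _ => inner k s
    _ = ∑ s ∈ Finset.range n, ∑ a ∈ Finset.range n, ∑ b ∈ Finset.range n,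
          640 * C ^ 2 * (pathMinExcess D s a b * ∑ k ∈ Finset.range m,
        (if max |(s : ℝ) - a| |(s : ℝ) - b| / (9 * C) ≤ 2 ^ k then 1 / ((2 : ℝ) ^ k) ^ 3
          else 0)) := by
        simp only [Finset.mul_sum]
        rw [Finset.sum_comm]
        refine Finset.sum_congr rfl fun s _ => ?_
        rw [Finset.sum_comm]
        refine Finset.sum_congr rfl fun a _ => ?_
        rw [Finset.sum_comm]
    _ ≤ ∑ s ∈ Finset.range n, ∑ a ∈ Finset.range n, ∑ b ∈ Finset.range n,
          640 * C ^ 2 * (1458 * C ^ 3 *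
            (pathMinExcess D s a b / max |(s : ℝ) - a| |(s : ℝ) - b| ^ 3)) := by
        refine Finset.sum_le_sum fun s _ => Finset.sum_le_sum fun a _ =>
          Finset.sum_le_sum fun b _ => ?_
        have hm0 := h.pathMinExcess_nonneg s a b
        refine mul_le_mul_of_nonneg_left ?_ (by positivity)
        rcases (le_max_of_le_left (abs_nonneg _) :
          0 ≤ max |(s : ℝ) - a| |(s : ℝ) - b|).eq_or_lt with h0 | h0
        · have hsa : s = a := by
            have h1 := le_max_left |(s : ℝ) - a| |(s : ℝ) - b|
            rw [← h0] at h1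
            have := abs_eq_zero.1 (le_antisymm h1 (abs_nonneg _))
            exact_mod_cast sub_eq_zero.1 this
          have h2 : pathMinExcess D s a b ≤ pathExcess D s a b := min_le_left _ _
          have h3 := h.pathExcess_le_two_mul_left s a b
          rw [hsa, h.self] at h3
          have : pathMinExcess D s a b = 0 := by rw [hsa] at h2 hm0 ⊢; linarith
          simp [this]
        · refine (mul_le_mul_of_nonneg_left (sum_dyadic_inv_cube_le (by positivity) m)
            hm0).trans_eq ?_
          field_simp
          ring
    _ ≤ 640 * C ^ 2 * (1458 * C ^ 3 * (48 * n)) := by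
        simp only [← Finset.mul_sum]
        gcongr
        exact h.sum_pathMinExcess_le
    _ = _ := by ring

/-- The discrete form of the main estimate. -/
theorem sum_pathMinExcess_div_pathDiam_le (h : IsRegularPath C n D) (hC : 1 ≤ C) :
    ∑ s ∈ Finset.range n, ∑ t ∈ Finset.range n, ∑ u ∈ Finset.range n,
      pathMinExcess D s t u / pathDiam D s t u ^ 3 ≤
    (1024 * C ^ 2 + 8192 * C ^ 2 * (4 * C * (98304 * C / (1 / (2 * C)) ^ 4 + 1))
      + 44789760 * C ^ 5) * n := by
  have p1 := h.sum_small_le (by linarith) (n + 1)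
  have p2 := h.sum_jumpWeight_le hC (n + 1)
  have p4 := h.sum_arcs_le hC (n + 1)
  have p2' : ∑ k ∈ Finset.range (n + 1), ∑ s ∈ Finset.range n, ∑ t ∈ Finset.range n,
      ∑ u ∈ Finset.range n, (if D t s ≤ 2 ^ k ∧ D t u ≤ 2 ^ k
          then 8 / ((2 : ℝ) ^ k) ^ 3 * jumpWeight D n (8 * C) t k else 0)
      ≤ 4096 * C ^ 2 * (4 * C * (98304 * C / (1 / (2 * C)) ^ 4 + 1)) * n := by
    refine le_trans (le_of_eq ?_) p2
    exact Finset.sum_congr rfl fun k _ => Finset.sum_comm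
  have p3 : ∑ k ∈ Finset.range (n + 1), ∑ s ∈ Finset.range n, ∑ t ∈ Finset.range n,
      ∑ u ∈ Finset.range n, (if D u s ≤ 2 ^ k ∧ D u t ≤ 2 ^ k
          then 8 / ((2 : ℝ) ^ k) ^ 3 * jumpWeight D n (8 * C) u k else 0)
      ≤ 4096 * C ^ 2 * (4 * C * (98304 * C / (1 / (2 * C)) ^ 4 + 1)) * n := by
    refine le_trans (le_of_eq ?_) p2'
    exact Finset.sum_congr rfl fun k _ => Finset.sum_congr rfl fun s _ => Finset.sum_comm
  have swap : ∀ f : ℕ → ℕ → ℕ → ℕ → ℝ, ∑ s ∈ Finset.range n, ∑ t ∈ Finset.range n,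
      ∑ u ∈ Finset.range n, ∑ k ∈ Finset.range (n + 1), f s t u k =
      ∑ k ∈ Finset.range (n + 1), ∑ s ∈ Finset.range n, ∑ t ∈ Finset.range n,
      ∑ u ∈ Finset.range n, f s t u k := by
    intro f
    rw [Finset.sum_comm (s := Finset.range (n + 1))]
    refine Finset.sum_congr rfl fun s _ => ?_
    rw [Finset.sum_comm (s := Finset.range (n + 1))]
    refine Finset.sum_congr rfl fun t _ => ?_
    rw [Finset.sum_comm (s := Finset.range (n + 1))]
  calc _ ≤ _ := Finset.sum_le_sum fun s hs => Finset.sum_le_sum fun t ht =>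
        Finset.sum_le_sum fun u hu => h.pathMinExcess_div_le_sum_scales hC
          (Finset.mem_range.1 hs) (Finset.mem_range.1 ht) (Finset.mem_range.1 hu)
    _ ≤ _ := by
        rw [swap]
        simp only [Finset.sum_add_distrib]
        linarith

end IsRegularPath

/-! ### Nets and the path through them -/

/-- Vertices are attached one at a time: a new `b` adjacent to a visited `a` replaces one occurrence
of `a` by the detour `a, b, a`. Each further visit to `x` is paid for by a new neighbour of `x`, so
bounded degree gives bounded multiplicity. -/
theorem exists_tour {α : Type*} [DecidableEq α] {X : Finset α} (hX : X.Nonempty)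
    {R : α → α → Prop} [DecidableRel R] (hsymm : ∀ a b, R a b → R b a)
    (hconn : ∀ S ⊆ X, S.Nonempty → S ≠ X → ∃ a ∈ S, ∃ b ∈ X, b ∉ S ∧ R a b) :
    ∃ l : List α, l.IsChain R ∧ l.toFinset = X ∧
      ∀ x, l.count x ≤ 1 + (X.filter fun y => R x y).card := by
  have key : ∀ m, m + 1 ≤ X.card → ∃ S ⊆ X, S.card = m + 1 ∧ ∃ l : List α, l.IsChain R ∧
      l.toFinset = S ∧ ∀ x, l.count x ≤ 1 + (S.filter fun y => R x y).card := by
    intro m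
    induction m with
    | zero =>
      intro _
      obtain ⟨x, hx⟩ := hX
      refine ⟨{x}, by simpa using hx, by simp, [x], by simp, by simp, fun y => ?_⟩
      exact (List.count_le_length).trans (by simp)
    | succ m ih =>
      intro hm
      obtain ⟨S, hSX, hS, l, hl, hlS, hcount⟩ := ih (by omega)
      obtain ⟨a, ha, b, hb, hbS, hab⟩ := hconn S hSX (Finset.card_pos.1 (by omega))
        (by rintro rfl; omega)
      refine ⟨insert b S, Finset.insert_subset hb hSX,
        by rw [Finset.card_insert_of_notMem hbS, hS], ?_⟩
      obtain ⟨l₁, l₂, rfl⟩ := List.append_of_mem (List.mem_toFinset.1 (hlS ▸ ha))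
      refine ⟨l₁ ++ a :: b :: a :: l₂, ?_, ?_, fun x => ?_⟩
      · rw [List.isChain_split] at hl ⊢
        refine ⟨hl.1, ?_⟩
        simp only [List.isChain_cons_cons]
        exact ⟨hab, hsymm _ _ hab, hl.2⟩
      · rw [← hlS]
        ext x
        simp only [List.mem_toFinset, List.mem_append, List.mem_cons, Finset.mem_insert]
        tauto
      · have hx := hcount x
        have hmono : (S.filter fun y => R x y).card ≤ ((insert b S).filter fun y => R x y).card :=
          Finset.card_le_card (Finset.filter_subset_filter _ (Finset.subset_insert _ _))
        rw [List.count_append, List.count_cons] at hx ⊢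
        rw [List.count_cons, List.count_cons]
        by_cases hxb : b = x
        · have h0 : (l₁ ++ a :: l₂).count x = 0 := by
            rw [List.count_eq_zero, ← List.mem_toFinset, hlS, ← hxb]
            exact hbS
          rw [List.count_append, List.count_cons] at h0
          have hax : a ≠ x := by
            rintro rfl
            exact hbS (hxb ▸ ha)
          simp only [hxb, beq_self_eq_true, beq_iff_eq, hax, if_true, if_false] at h0 ⊢
          omega
        · by_cases hax : a = x
          · have : ((insert b S).filter fun y => R x y).card
                = (S.filter fun y => R x y).card + 1 := by
              rw [Finset.filter_insert, if_pos (hax ▸ hab), Finset.card_insert_of_notMem]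
              simp [hbS]
            simp only [hax, hxb, beq_self_eq_true, beq_iff_eq, if_true, if_false] at hx ⊢
            omega
          · simp only [hax, hxb, beq_iff_eq, if_false] at hx ⊢
            omega
  obtain ⟨S, hSX, hS, l, hl, hlS, hcount⟩ := key (X.card - 1)
    (by have := hX.card_pos; omega)
  have : S = X := Finset.eq_of_subset_of_card_le hSX (by omega)
  subst this
  exact ⟨l, hl, hlS, hcount⟩

theorem List.card_filter_getD_eq {α : Type*} [DecidableEq α] (l : List α) (d x : α) :
    ((Finset.range l.length).filter fun t => l.getD t d = x).card = l.count x := by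
  induction l with
  | nil => simp
  | cons a l ih =>
    rw [List.length_cons, Finset.card_filter, Finset.sum_range_succ', ← Finset.card_filter,
      List.count_cons]
    simp only [List.getD_cons_succ, List.getD_cons_zero, ih, beq_iff_eq]

/-- The closed `ε`-balls about `S` and about its complement in `X` cover `K`; by preconnectedness
the two closed unions share a point, which links the two classes. -/
theorem net_connected {M : Type*} [MetricSpace M] {K : Set M} (hK : IsPreconnected K) {ε : ℝ}
    {X : Finset M} (hXK : ↑X ⊆ K) (hε : 0 ≤ ε) (hnet : ∀ y ∈ K, ∃ x ∈ X, dist y x ≤ ε) :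
    ∀ S ⊆ X, S.Nonempty → S ≠ X → ∃ a ∈ S, ∃ b ∈ X, b ∉ S ∧ dist a b ≤ 2 * ε := by
  classical
  intro S hSX hS hne
  have hcl : ∀ T : Finset M, IsClosed (⋃ x ∈ T, Metric.closedBall x ε) := fun T =>
    T.finite_toSet.isClosed_biUnion fun _ _ => Metric.isClosed_closedBall
  have hcov : K ⊆ (⋃ x ∈ S, Metric.closedBall x ε) ∪ ⋃ x ∈ X \ S, Metric.closedBall x ε := by
    intro y hy
    obtain ⟨x, hx, hyx⟩ := hnet y hy
    by_cases hxS : x ∈ S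
    · exact Or.inl (Set.mem_biUnion hxS hyx)
    · exact Or.inr (Set.mem_biUnion (Finset.mem_coe.2 (Finset.mem_sdiff.2 ⟨hx, hxS⟩)) hyx)
  obtain ⟨a, ha⟩ := hS
  obtain ⟨b, hb⟩ : (X \ S).Nonempty := by
    rw [Finset.sdiff_nonempty]
    exact fun h => hne (Finset.Subset.antisymm hSX h)
  obtain ⟨y, -, hy1, hy2⟩ := isPreconnected_closed_iff.1 hK _ _ (hcl S) (hcl (X \ S)) hcov
    ⟨a, hXK (hSX ha), Set.mem_biUnion (Finset.mem_coe.2 ha) (Metric.mem_closedBall_self hε)⟩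
    ⟨b, hXK (Finset.mem_sdiff.1 hb).1, Set.mem_biUnion (Finset.mem_coe.2 hb)
      (Metric.mem_closedBall_self hε)⟩
  simp only [Set.mem_iUnion, Metric.mem_closedBall, exists_prop, Finset.mem_sdiff] at hy1 hy2
  obtain ⟨a', ha', hya⟩ := hy1
  obtain ⟨b', hb', hyb⟩ := hy2
  refine ⟨a', ha', b', hb'.1, hb'.2, ?_⟩
  have := dist_triangle_left a' b' y
  linarith

section Net

variable {M : Type*} [MetricSpace M] [MeasurableSpace M] [BorelSpace M]

theorem card_mul_le_of_separated {ν : Measure M} {X : Finset M} {ε : ℝ} {κ : ℝ≥0∞} {B : Set M}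
    (hsep : ∀ x ∈ X, ∀ y ∈ X, x ≠ y → ε < dist x y)
    (hκ : ∀ x ∈ X, κ ≤ ν (Metric.closedBall x (ε / 2)))
    (hB : ∀ x ∈ X, Metric.closedBall x (ε / 2) ⊆ B) : X.card * κ ≤ ν B := by
  calc X.card * κ = ∑ x ∈ X, κ := by simp
    _ ≤ ∑ x ∈ X, ν (Metric.closedBall x (ε / 2)) := Finset.sum_le_sum hκ
    _ = ν (⋃ x ∈ X, Metric.closedBall x (ε / 2)) := by
        rw [measure_biUnion_finset]
        · intro x hx y hy hxy
          exact Metric.closedBall_disjoint_closedBall (by linarith [hsep x hx y hy hxy])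
        · exact fun x _ => Metric.isClosed_closedBall.measurableSet
    _ ≤ ν B := measure_mono (Set.iUnion₂_subset hB)

/-- Otherwise separated sets could be extended indefinitely, and their disjoint balls of mass at
least `κ` would exceed the finite total mass. -/
theorem exists_finite_net {ν : Measure M} {K : Set M} {ε : ℝ} {κ : ℝ≥0∞} (hκ0 : κ ≠ 0)
    (hν : ν Set.univ ≠ ⊤) (hκ : ∀ x ∈ K, κ ≤ ν (Metric.closedBall x (ε / 2))) :
    ∃ X : Finset M, ↑X ⊆ K ∧ (∀ x ∈ X, ∀ y ∈ X, x ≠ y → ε < dist x y) ∧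
      ∀ y ∈ K, ∃ x ∈ X, dist y x ≤ ε := by
  classical
  by_contra! hcon
  have key : ∀ m : ℕ, ∃ X : Finset M, ↑X ⊆ K ∧ (∀ x ∈ X, ∀ y ∈ X, x ≠ y → ε < dist x y) ∧
      X.card = m := by
    intro m
    induction m with
    | zero => exact ⟨∅, by simp, by simp, rfl⟩
    | succ m ih =>
      obtain ⟨X, hXK, hX, hm⟩ := ih
      obtain ⟨y, hy, hyX⟩ := hcon X hXK hX
      -- The sign of `ε` is not assumed; a negative `ε` would make the balls empty, against `κ ≠ 0`.
      by_cases hyX' : y ∈ X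
      · exfalso
        have hε : ε < 0 := by simpa using hyX y hyX'
        have := hκ y hy
        rw [Metric.closedBall_eq_empty.2 (by linarith), measure_empty] at this
        exact hκ0 (le_antisymm this bot_le)
      refine ⟨insert y X, ?_, ?_, by rw [Finset.card_insert_of_notMem hyX', hm]⟩
      · rw [Finset.coe_insert]
        exact Set.insert_subset hy hXK
      · intro a ha b hb hab
        rcases Finset.mem_insert.1 ha with ha' | ha' <;>
          rcases Finset.mem_insert.1 hb with hb' | hb'
        · exact absurd (ha'.trans hb'.symm) hab
        · rw [ha']
          exact hyX b hb'
        · rw [hb', dist_comm]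
          exact hyX a ha'
        · exact hX a ha' b hb' hab
  have hκν : ∀ m : ℕ, m * κ ≤ ν Set.univ := by
    intro m
    obtain ⟨X, hXK, hX, rfl⟩ := key m
    exact card_mul_le_of_separated hX (fun x hx => hκ x (hXK hx)) fun _ _ => Set.subset_univ _
  obtain ⟨m, hm⟩ := ENNReal.exists_nat_mul_gt hκ0 hν
  exact absurd (hκν m) (not_le.2 hm)

end Net

section Path

variable {M : Type*} [MetricSpace M] [MeasurableSpace M] [BorelSpace M]

theorem card_net_closedBall_le {ν : Measure M} {K : Set M} {C ε : ℝ} (hC : 0 < C) (hε : 0 < ε)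
    (hlow : ∀ x ∈ K, ENNReal.ofReal (ε / 2 / C) ≤ ν (Metric.closedBall x (ε / 2)))
    (hup : ∀ x ∈ K, ∀ r, 0 < r → ν (Metric.closedBall x r) ≤ ENNReal.ofReal (C * r))
    {X : Finset M} (hXK : ↑X ⊆ K) (hsep : ∀ x ∈ X, ∀ y ∈ X, x ≠ y → ε < dist x y)
    {x : M} (hx : x ∈ K) {r : ℝ} (hr : 1 ≤ r) :
    ((X.filter fun y => dist x y ≤ 2 * ε * r).card : ℝ) ≤ 5 * C ^ 2 * r := by
  have h1 := card_mul_le_of_separated (ν := ν) (X := X.filter fun y => dist x y ≤ 2 * ε * r)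
    (ε := ε) (κ := ENNReal.ofReal (ε / 2 / C)) (B := Metric.closedBall x (2 * ε * r + ε / 2))
    (fun a ha b hb hab => hsep a (Finset.mem_filter.1 ha).1 b (Finset.mem_filter.1 hb).1 hab)
    (fun a ha => hlow a (hXK (Finset.mem_filter.1 ha).1))
    (fun a ha => by
      refine Metric.closedBall_subset_closedBall' ?_
      have := (Finset.mem_filter.1 ha).2
      rw [dist_comm] at this
      linarith)
  have h2 := h1.trans (hup x hx _ (by positivity))
  rw [← ENNReal.ofReal_natCast, ← ENNReal.ofReal_mul (Nat.cast_nonneg _),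
    ENNReal.ofReal_le_ofReal_iff (by positivity)] at h2
  rw [div_div, mul_div_assoc', div_le_iff₀ (by positivity)] at h2
  have h3 : C * (2 * ε * r + ε / 2) * (2 * C) ≤ 5 * C ^ 2 * r * ε := by
    have : C ^ 2 * ε ≤ C ^ 2 * ε * r := le_mul_of_one_le_right (by positivity) hr
    linarith
  exact le_of_mul_le_mul_right (h2.trans h3) hε

/-- Distances are divided by `2 * ε`: net neighbours get distance at most `1`, distinct net points
more than `1 / 2`. The regularity constant is the multiplicity bound `1 + 5 * C ^ 2` of the walk
times the bound `5 * C ^ 2` for net points in a ball, enlarged to a square. -/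
theorem exists_regularPath {ν : Measure M} {K : Set M} (hK : IsPreconnected K) (hne : K.Nonempty)
    {C ε : ℝ} (hC : 0 < C) (hε : 0 < ε) (hν : ν Set.univ ≠ ⊤)
    (hlow : ∀ x ∈ K, ENNReal.ofReal (ε / 2 / C) ≤ ν (Metric.closedBall x (ε / 2)))
    (hup : ∀ x ∈ K, ∀ r, 0 < r → ν (Metric.closedBall x r) ≤ ENNReal.ofReal (C * r)) :
    ∃ (n : ℕ) (γ : ℕ → M), 0 < n ∧ (∀ s, γ s ∈ K) ∧
      (∀ y ∈ K, ∃ s < n, dist y (γ s) ≤ ε) ∧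
      IsRegularPath ((1 + 5 * C ^ 2) ^ 2) n (fun s t => dist (γ s) (γ t) / (2 * ε)) ∧
      n * ENNReal.ofReal ε ≤ ENNReal.ofReal (2 * C * (1 + 5 * C ^ 2)) * ν Set.univ := by
  classical
  obtain ⟨X, hXK, hsep, hnet⟩ := exists_finite_net (ν := ν) (K := K) (ε := ε)
    (κ := ENNReal.ofReal (ε / 2 / C)) (by simp; positivity) hν hlow
  have hXne : X.Nonempty := by
    obtain ⟨y, hy⟩ := hne
    obtain ⟨x, hx, -⟩ := hnet y hy
    exact ⟨x, hx⟩
  obtain ⟨l, hchain, hlX, hcount⟩ := exists_tour hXne (R := fun x y => dist x y ≤ 2 * ε)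
    (fun a b hab => by rwa [dist_comm]) (net_connected hK hXK hε.le hnet)
  have hl : l ≠ [] := by
    rintro rfl
    simp only [List.toFinset_nil] at hlX
    exact hXne.ne_empty hlX.symm
  have hpos : 0 < l.length := List.length_pos_iff.2 hl
  -- Past its end the path stays at its last point, so the step bound holds for all parameters.
  set d := l.getLast hl with hd
  set γ : ℕ → M := fun s => l.getD s d with hγ
  have hγlt : ∀ s (hs : s < l.length), γ s = l[s] := fun s hs => List.getD_eq_getElem l d hs
  have hγge : ∀ s, l.length ≤ s → γ s = d := fun s hs => List.getD_eq_default l d hs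
  have hlast : γ (l.length - 1) = d := by
    rw [hγlt _ (by omega), hd, List.getLast_eq_getElem]
  have hsurj : ∀ s, ∃ t < l.length, γ t = γ s := by
    intro s
    rcases lt_or_ge s l.length with hs | hs
    · exact ⟨s, hs, rfl⟩
    · exact ⟨l.length - 1, by omega, by rw [hlast, hγge s hs]⟩
  have hγX : ∀ s, γ s ∈ X := by
    intro s
    obtain ⟨t, ht, hts⟩ := hsurj s
    rw [← hts, hγlt t ht, ← hlX, List.mem_toFinset]
    exact List.getElem_mem ht
  have hXγ : ∀ x ∈ X, ∃ s < l.length, γ s = x := by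
    intro x hx
    rw [← hlX, List.mem_toFinset] at hx
    obtain ⟨s, hs, hsx⟩ := List.getElem_of_mem hx
    exact ⟨s, hs, by rw [hγlt s hs, hsx]⟩
  have hball := fun (x : M) (hx : x ∈ K) (r : ℝ) (hr : 1 ≤ r) =>
    card_net_closedBall_le hC hε hlow hup hXK hsep hx hr
  have hmult : ∀ x ∈ X, (l.count x : ℝ) ≤ 1 + 5 * C ^ 2 := by
    intro x hx
    have h1 := hball x (hXK hx) 1 le_rfl
    simp only [mul_one] at h1
    have h2 : (l.count x : ℝ) ≤ (1 + (X.filter fun y => dist x y ≤ 2 * ε).card : ℕ) :=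
      Nat.cast_le.2 (hcount x)
    push_cast at h2
    linarith
  have hfib : ∀ Y ⊆ X, (((Finset.range l.length).filter fun t => γ t ∈ Y).card : ℝ) ≤
      (1 + 5 * C ^ 2) * Y.card := by
    intro Y hY
    have h1 := Finset.card_le_mul_card_image_of_maps_to
      (s := (Finset.range l.length).filter fun t => γ t ∈ Y) (f := γ) (t := Y)
      (fun t ht => (Finset.mem_filter.1 ht).2) ⌊1 + 5 * C ^ 2⌋₊ (fun x hx => by
        rw [Nat.le_floor_iff (by positivity)]
        refine le_trans (Nat.cast_le.2 ?_) (hmult x (hY hx))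
        rw [← List.card_filter_getD_eq l d x]
        refine Finset.card_le_card fun t ht => ?_
        simp only [Finset.mem_filter] at ht ⊢
        exact ⟨ht.1.1, ht.2⟩)
    calc _ ≤ ((⌊1 + 5 * C ^ 2⌋₊ * Y.card : ℕ) : ℝ) := Nat.cast_le.2 h1
      _ = ⌊1 + 5 * C ^ 2⌋₊ * (Y.card : ℝ) := by push_cast; ring
      _ ≤ _ := by
        gcongr
        exact Nat.floor_le (by positivity)
  refine ⟨l.length, γ, hpos, fun s => hXK (hγX s), ?_, ?_, ?_⟩
  · intro y hy
    obtain ⟨x, hx, hyx⟩ := hnet y hy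
    obtain ⟨s, hs, rfl⟩ := hXγ x hx
    exact ⟨s, hs, hyx⟩
  · refine ⟨fun s => by simp, fun s t => by rw [dist_comm], fun s t u => ?_, fun s => ?_,
      fun s r hr => ?_, fun s t => ?_⟩
    · rw [← add_div]
      gcongr
      exact dist_triangle _ _ _
    · rw [div_le_one (by positivity)]
      rcases lt_or_ge (s + 1) l.length with hs | hs
      · rw [hγlt (s + 1) hs, hγlt s (by omega)]
        exact List.isChain_iff_getElem.1 hchain s hs
      · have : γ s = d := by
          rcases lt_or_ge s l.length with hs' | hs'
          · rw [show s = l.length - 1 by omega, hlast]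
          · exact hγge s hs'
        rw [this, hγge _ hs, dist_self]
        positivity
    · have h1 := hfib (X.filter fun y => dist (γ s) y ≤ 2 * ε * r) (Finset.filter_subset _ _)
      have h2 := hball (γ s) (hXK (hγX s)) r hr
      have e : ((Finset.range l.length).filter fun t => dist (γ s) (γ t) / (2 * ε) ≤ r) =
          (Finset.range l.length).filter
            fun t => γ t ∈ X.filter fun y => dist (γ s) y ≤ 2 * ε * r := by
        refine Finset.filter_congr fun t _ => ?_
        rw [div_le_iff₀ (by positivity), Finset.mem_filter, mul_comm r]
        simp [hγX t]
      rw [e]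
      refine h1.trans ?_
      calc _ ≤ (1 + 5 * C ^ 2) * (5 * C ^ 2 * r) := by gcongr
        _ ≤ (1 + 5 * C ^ 2) * ((1 + 5 * C ^ 2) * r) := by
          gcongr
          linarith
        _ = _ := by ring
    · by_cases hst : γ s = γ t
      · left
        simp [hst]
      · right
        rw [div_le_div_iff₀ (by norm_num) (by positivity)]
        have := hsep _ (hγX s) _ (hγX t) hst
        linarith
  · have h1 := hfib X subset_rfl
    rw [Finset.filter_true_of_mem (fun t _ => hγX t), Finset.card_range] at h1
    have h2 := card_mul_le_of_separated (ν := ν) hsep (fun x hx => hlow x (hXK hx))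
      fun _ _ => Set.subset_univ _
    calc (l.length : ℝ≥0∞) * ENNReal.ofReal ε
        = ENNReal.ofReal (l.length * ε) := by
          rw [ENNReal.ofReal_mul (Nat.cast_nonneg _), ENNReal.ofReal_natCast]
      _ ≤ ENNReal.ofReal (2 * C * (1 + 5 * C ^ 2) * (X.card * (ε / 2 / C))) := by
          refine ENNReal.ofReal_le_ofReal ?_
          calc (l.length : ℝ) * ε ≤ (1 + 5 * C ^ 2) * X.card * ε := by gcongr
            _ = _ := by field_simp
      _ = ENNReal.ofReal (2 * C * (1 + 5 * C ^ 2)) * (X.card * ENNReal.ofReal (ε / 2 / C)) := by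
          rw [ENNReal.ofReal_mul (by positivity), ENNReal.ofReal_mul (Nat.cast_nonneg _),
            ENNReal.ofReal_natCast]
      _ ≤ _ := by gcongr

end Path

/-! ### From the discrete sum to the integral -/

theorem minExcess_nonneg {M : Type*} [MetricSpace M] (x y z : M) : 0 ≤ minExcess x y z := by
  have h1 := dist_triangle x y z
  have h2 := dist_triangle y z x
  have h3 := dist_triangle z x y
  unfold minExcess excess
  exact le_min (by linarith) (le_min (by linarith) (by linarith))

theorem minExcess_div_diam_eq {M : Type*} [MetricSpace M] (γ : ℕ → M) {a : ℝ} (ha : 0 < a)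
    (s t u : ℕ) :
    minExcess (γ s) (γ t) (γ u) / Metric.diam {γ s, γ t, γ u} ^ 3 =
      1 / a ^ 2 * (pathMinExcess (fun s t => dist (γ s) (γ t) / a) s t u /
        pathDiam (fun s t => dist (γ s) (γ t) / a) s t u ^ 3) := by
  have e1 : pathMinExcess (fun s t => dist (γ s) (γ t) / a) s t u
      = minExcess (γ s) (γ t) (γ u) / a := by
    unfold pathMinExcess pathExcess minExcess excess
    simp only [← add_div, ← sub_div, min_div_div_right ha.le]
  have e2 : pathDiam (fun s t => dist (γ s) (γ t) / a) s t u
      = Metric.diam {γ s, γ t, γ u} / a := by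
    unfold pathDiam
    rw [Metric.diam_triple, max_div_div_right ha.le, max_div_div_right ha.le, max_assoc,
      max_comm (dist (γ s) (γ u))]
  rw [e1, e2]
  field_simp

open Filter Topology in
theorem tendsto_minExcess_div_diam {M : Type*} [MetricSpace M] {x y z : M} {u v w : ℕ → M}
    (hu : Tendsto u atTop (𝓝 x)) (hv : Tendsto v atTop (𝓝 y)) (hw : Tendsto w atTop (𝓝 z))
    (h : Metric.diam {x, y, z} ≠ 0) :
    Tendsto (fun j => minExcess (u j) (v j) (w j) / Metric.diam {u j, v j, w j} ^ 3) atTop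
      (𝓝 (minExcess x y z / Metric.diam {x, y, z} ^ 3)) := by
  refine Tendsto.div ?_ (Tendsto.pow ?_ 3) (pow_ne_zero 3 h)
  · unfold minExcess excess
    exact (((hu.dist hv).add (hv.dist hw)).sub (hu.dist hw)).min
      ((((hv.dist hw).add (hw.dist hu)).sub (hv.dist hu)).min
      (((hw.dist hu).add (hu.dist hv)).sub (hw.dist hv)))
  · simp only [Metric.diam_triple]
    exact ((hu.dist hv).max (hu.dist hw)).max (hv.dist hw)

section Integral

variable {M : Type*} [MeasurableSpace M]

/-- Composition with a simple function makes every `g` measurable. Repeated values of `γ` only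
enlarge the right side. -/
theorem lintegral_simpleFunc_le {ν : Measure M} {π : SimpleFunc M M} {n : ℕ} {γ : ℕ → M} {κ : ℝ≥0∞}
    (hπ : ∀ x, ∃ s < n, π x = γ s) (hκ : ∀ s, ν (π ⁻¹' {γ s}) ≤ κ) (g : M → ℝ≥0∞) :
    ∫⁻ z, g (π z) ∂ν ≤ κ * ∑ s ∈ Finset.range n, g (γ s) := by
  classical
  have e : ∫⁻ z, g (π z) ∂ν = ∑ p ∈ π.range, g p * ν (π ⁻¹' {p}) := by
    rw [← SimpleFunc.map_lintegral, ← SimpleFunc.lintegral_eq_lintegral]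
    rfl
  have hsub : π.range ⊆ (Finset.range n).image γ := by
    intro p hp
    obtain ⟨x, rfl⟩ := SimpleFunc.mem_range.1 hp
    obtain ⟨s, hs, hx⟩ := hπ x
    rw [hx]
    exact Finset.mem_image_of_mem _ (Finset.mem_range.2 hs)
  have himage : ∑ p ∈ (Finset.range n).image γ, g p * κ ≤ ∑ s ∈ Finset.range n, g (γ s) * κ := by
    rw [← Finset.sum_fiberwise_of_maps_to
      (g := γ) (t := (Finset.range n).image γ) (fun s hs => Finset.mem_image_of_mem _ hs)]
    refine Finset.sum_le_sum fun p hp => ?_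
    obtain ⟨s, hs, rfl⟩ := Finset.mem_image.1 hp
    exact Finset.single_le_sum (f := fun s => g (γ s) * κ) (fun _ _ => bot_le)
      (Finset.mem_filter.2 ⟨hs, rfl⟩)
  rw [e, mul_comm, Finset.sum_mul]
  refine le_trans (Finset.sum_le_sum fun p hp => ?_)
    ((Finset.sum_le_sum_of_subset hsub).trans himage)
  obtain ⟨s, -, rfl⟩ := Finset.mem_image.1 (hsub hp)
  gcongr
  exact hκ s

theorem lintegral_triple_simpleFunc_le {ν : Measure M} {π : SimpleFunc M M} {n : ℕ} {γ : ℕ → M}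
    {κ : ℝ≥0∞} (hπ : ∀ x, ∃ s < n, π x = γ s) (hκ : ∀ s, ν (π ⁻¹' {γ s}) ≤ κ)
    (f : M → M → M → ℝ≥0∞) :
    ∫⁻ x, ∫⁻ y, ∫⁻ z, f (π x) (π y) (π z) ∂ν ∂ν ∂ν ≤ κ ^ 3 * ∑ s ∈ Finset.range n,
      ∑ t ∈ Finset.range n, ∑ u ∈ Finset.range n, f (γ s) (γ t) (γ u) := by
  refine (lintegral_simpleFunc_le hπ hκ fun p => ∫⁻ y, ∫⁻ z, f p (π y) (π z) ∂ν ∂ν).trans ?_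
  have h1 : ∀ p, ∫⁻ y, ∫⁻ z, f p (π y) (π z) ∂ν ∂ν ≤ κ ^ 2 * ∑ t ∈ Finset.range n,
      ∑ u ∈ Finset.range n, f p (γ t) (γ u) := by
    intro p
    refine (lintegral_simpleFunc_le hπ hκ fun q => ∫⁻ z, f p q (π z) ∂ν).trans ?_
    rw [sq, mul_assoc]
    refine mul_le_mul' le_rfl ?_
    rw [Finset.mul_sum]
    exact (Finset.sum_le_sum fun t _ =>
      lintegral_simpleFunc_le hπ hκ fun r => f p (γ t) r)
  rw [pow_succ' κ 2, mul_assoc]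
  refine mul_le_mul' le_rfl ?_
  rw [Finset.mul_sum]
  exact Finset.sum_le_sum fun s _ => h1 (γ s)

open Filter Topology in
/-- Fatou's lemma for iterated integrals of functions discretized by simple functions. -/
theorem lintegral_triple_le_of_discretization {ν : Measure M} {π : ℕ → SimpleFunc M M}
    {f : M → M → M → ℝ≥0∞} {S : Set M} (hS : ∀ᵐ x ∂ν, x ∈ S)
    (hf : ∀ x ∈ S, ∀ y ∈ S, ∀ z ∈ S,
      f x y z ≤ liminf (fun j => f (π j x) (π j y) (π j z)) atTop)
    {b : ℝ≥0∞} (hb : ∀ j, ∫⁻ x, ∫⁻ y, ∫⁻ z, f (π j x) (π j y) (π j z) ∂ν ∂ν ∂ν ≤ b) :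
    ∫⁻ x, ∫⁻ y, ∫⁻ z, f x y z ∂ν ∂ν ∂ν ≤ b := by
  have m : ∀ (j : ℕ) (g : M → ℝ≥0∞), Measurable fun x => g (π j x) := fun j g =>
    ((π j).map g).measurable
  calc ∫⁻ x, ∫⁻ y, ∫⁻ z, f x y z ∂ν ∂ν ∂ν
      ≤ ∫⁻ x, ∫⁻ y, ∫⁻ z, liminf (fun j => f (π j x) (π j y) (π j z)) atTop ∂ν ∂ν ∂ν := by
        refine lintegral_mono_ae (hS.mono fun x hx => ?_)
        refine lintegral_mono_ae (hS.mono fun y hy => ?_)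
        exact lintegral_mono_ae (hS.mono fun z hz => hf x hx y hy z hz)
    _ ≤ ∫⁻ x, ∫⁻ y, liminf (fun j => ∫⁻ z, f (π j x) (π j y) (π j z) ∂ν) atTop ∂ν ∂ν :=
        lintegral_mono fun x => lintegral_mono fun y =>
          lintegral_liminf_le fun j => m j fun r => f (π j x) (π j y) r
    _ ≤ ∫⁻ x, liminf (fun j => ∫⁻ y, ∫⁻ z, f (π j x) (π j y) (π j z) ∂ν ∂ν) atTop ∂ν :=
        lintegral_mono fun x =>
          lintegral_liminf_le fun j => m j fun q => ∫⁻ z, f (π j x) q (π j z) ∂ν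
    _ ≤ liminf (fun j => ∫⁻ x, ∫⁻ y, ∫⁻ z, f (π j x) (π j y) (π j z) ∂ν ∂ν ∂ν) atTop :=
        lintegral_liminf_le fun j => m j fun p => ∫⁻ y, ∫⁻ z, f p (π j y) (π j z) ∂ν ∂ν
    _ ≤ liminf (fun _ => b) atTop := liminf_le_liminf (Eventually.of_forall hb)
    _ = b := by simp

end Integral

/-- The constant of the discrete estimate. -/
noncomputable def discreteConst (C : ℝ) : ℝ :=
  1024 * C ^ 2 + 8192 * C ^ 2 * (4 * C * (98304 * C / (1 / (2 * C)) ^ 4 + 1))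
      + 44789760 * C ^ 5

/-- The constant of the integral estimate. -/
noncomputable def integralConst (C : ℝ) : ℝ :=
  C ^ 4 * (1 + 5 * C ^ 2) / 2 * discreteConst ((1 + 5 * C ^ 2) ^ 2)

theorem discreteConst_nonneg {C : ℝ} (hC : 0 ≤ C) : 0 ≤ discreteConst C := by
  unfold discreteConst
  positivity

section Regular

variable {M : Type*} [MetricSpace M] [MeasurableSpace M] [BorelSpace M]

/-- The fibres of the projection have mass at most `C * ε`. Three of them give `ε ^ 3`, the
integrand scales like `ε ^ (-2)`, and the remaining `n * ε` is bounded by the total mass. -/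
theorem exists_discretization {ν : Measure M} {K : Set M} (hK : IsPreconnected K)
    (hne : K.Nonempty) (hae : ∀ᵐ x ∂ν, x ∈ closure K)
    {C ε : ℝ} (hC : 0 < C) (hε : 0 < ε) (hν : ν Set.univ ≠ ⊤)
    (hlow : ∀ x ∈ K, ENNReal.ofReal (ε / 2 / C) ≤ ν (Metric.closedBall x (ε / 2)))
    (hup : ∀ x ∈ K, ∀ r, 0 < r → ν (Metric.closedBall x r) ≤ ENNReal.ofReal (C * r)) :
    ∃ π : SimpleFunc M M, (∀ y ∈ closure K, dist (π y) y ≤ ε) ∧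
      ∫⁻ x, ∫⁻ y, ∫⁻ z, ENNReal.ofReal
        (minExcess (π x) (π y) (π z) / Metric.diam {π x, π y, π z} ^ 3) ∂ν ∂ν ∂ν ≤
      ENNReal.ofReal (integralConst C) * ν Set.univ := by
  obtain ⟨n, γ, hn, hγK, hnet, hpath, hcard⟩ := exists_regularPath hK hne hC hε hν hlow hup
  -- `nearestPt γ N` uses the indices `0, …, N`, hence `n - 1`.
  set π := SimpleFunc.nearestPt γ (n - 1) with hπdef
  have hπ : ∀ x, ∃ s < n, π x = γ s := fun x =>
    ⟨SimpleFunc.nearestPtInd γ (n - 1) x,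
      by have := SimpleFunc.nearestPtInd_le γ (n - 1) x; omega, rfl⟩
  have hclose : ∀ y ∈ closure K, dist (π y) y ≤ ε := by
    intro y hy
    have hcl : IsClosed (⋃ s ∈ Finset.range n, Metric.closedBall (γ s) ε) :=
      (Finset.range n).finite_toSet.isClosed_biUnion fun _ _ => Metric.isClosed_closedBall
    have hsub : K ⊆ ⋃ s ∈ Finset.range n, Metric.closedBall (γ s) ε := by
      intro x hx
      obtain ⟨s, hs, hxs⟩ := hnet x hx
      exact Set.mem_biUnion (Finset.mem_coe.2 (Finset.mem_range.2 hs)) hxs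
    have hy' := closure_minimal hsub hcl hy
    simp only [Set.mem_iUnion, Finset.mem_range, Metric.mem_closedBall, exists_prop] at hy'
    obtain ⟨s, hs, hys⟩ := hy'
    have := SimpleFunc.edist_nearestPt_le γ y (by omega : s ≤ n - 1)
    rw [edist_dist, edist_dist, ENNReal.ofReal_le_ofReal_iff dist_nonneg] at this
    rw [dist_comm] at hys
    exact this.trans hys
  refine ⟨π, hclose, ?_⟩
  have hκ : ∀ s, ν (π ⁻¹' {γ s}) ≤ ENNReal.ofReal (C * ε) := by
    intro s
    refine le_trans (measure_mono_ae ?_) (hup (γ s) (hγK s) ε hε)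
    filter_upwards [hae] with y hy hys
    have h1 : π y = γ s := hys
    have h2 := hclose y hy
    rw [h1, dist_comm] at h2
    exact h2
  refine (lintegral_triple_simpleFunc_le hπ hκ fun x y z =>
    ENNReal.ofReal (minExcess x y z / Metric.diam {x, y, z} ^ 3)).trans ?_
  have hnn : ∀ x y z : M, 0 ≤ minExcess x y z / Metric.diam {x, y, z} ^ 3 := fun x y z =>
    div_nonneg (minExcess_nonneg x y z) (pow_nonneg Metric.diam_nonneg 3)
  have h1C : 1 ≤ (1 + 5 * C ^ 2) ^ 2 := one_le_pow₀ (by nlinarith [sq_nonneg C])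
  have hsum : ∑ s ∈ Finset.range n, ∑ t ∈ Finset.range n, ∑ u ∈ Finset.range n,
      ENNReal.ofReal (minExcess (γ s) (γ t) (γ u) / Metric.diam {γ s, γ t, γ u} ^ 3) ≤
      ENNReal.ofReal (1 / (2 * ε) ^ 2 * (discreteConst ((1 + 5 * C ^ 2) ^ 2) * n)) := by
    have e : ∑ s ∈ Finset.range n, ∑ t ∈ Finset.range n, ∑ u ∈ Finset.range n,
      ENNReal.ofReal (minExcess (γ s) (γ t) (γ u) / Metric.diam {γ s, γ t, γ u} ^ 3) =
      ENNReal.ofReal (∑ s ∈ Finset.range n, ∑ t ∈ Finset.range n, ∑ u ∈ Finset.range n,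
        minExcess (γ s) (γ t) (γ u) / Metric.diam {γ s, γ t, γ u} ^ 3) := by
      rw [ENNReal.ofReal_sum_of_nonneg fun _ _ =>
        Finset.sum_nonneg fun _ _ => Finset.sum_nonneg fun _ _ => hnn _ _ _]
      refine Finset.sum_congr rfl fun s _ => ?_
      rw [ENNReal.ofReal_sum_of_nonneg fun _ _ => Finset.sum_nonneg fun _ _ => hnn _ _ _]
      refine Finset.sum_congr rfl fun t _ => ?_
      rw [ENNReal.ofReal_sum_of_nonneg fun _ _ => hnn _ _ _]
    rw [e]
    refine ENNReal.ofReal_le_ofReal ?_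
    simp only [minExcess_div_diam_eq γ (by positivity : 0 < 2 * ε), ← Finset.mul_sum]
    gcongr
    exact hpath.sum_pathMinExcess_div_pathDiam_le h1C
  have hd0 := discreteConst_nonneg (C := (1 + 5 * C ^ 2) ^ 2) (by positivity)
  calc _ ≤ ENNReal.ofReal (C * ε) ^ 3 *
        ENNReal.ofReal (1 / (2 * ε) ^ 2 * (discreteConst ((1 + 5 * C ^ 2) ^ 2) * n)) := by
        gcongr
    _ = ENNReal.ofReal (C ^ 3 / 4 * discreteConst ((1 + 5 * C ^ 2) ^ 2)) *
          (n * ENNReal.ofReal ε) := by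
        rw [← ENNReal.ofReal_pow (by positivity), ← ENNReal.ofReal_mul (by positivity),
          ← ENNReal.ofReal_natCast n, ← ENNReal.ofReal_mul (by positivity),
          ← ENNReal.ofReal_mul (by positivity)]
        congr 1
        field_simp
        ring
    _ ≤ ENNReal.ofReal (C ^ 3 / 4 * discreteConst ((1 + 5 * C ^ 2) ^ 2)) *
          (ENNReal.ofReal (2 * C * (1 + 5 * C ^ 2)) * ν Set.univ) := by gcongr
    _ = _ := by
        rw [← mul_assoc, ← ENNReal.ofReal_mul (by positivity)]
        congr 2
        unfold integralConst
        ring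

open Filter Topology in
theorem lintegral_minExcess_le {K : Set M} {C : ℝ} (hK : IsPreconnected K)
    (hreg : IsOneAhlforsRegular C K) :
    ∫⁻ x in K, ∫⁻ y in K, ∫⁻ z in K, ENNReal.ofReal (minExcess x y z / Metric.diam {x, y, z} ^ 3)
      ∂(Measure.hausdorffMeasure 1) ∂(Measure.hausdorffMeasure 1) ∂(Measure.hausdorffMeasure 1)
    ≤ ((integralConst C).toNNReal + 1 : ℝ≥0) * Measure.hausdorffMeasure 1 K := by
  obtain ⟨hC, hreg⟩ := hreg
  set ν : Measure M := (Measure.hausdorffMeasure 1).restrict K with hν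
  have huniv : ν Set.univ = Measure.hausdorffMeasure 1 K := by
    rw [hν, Measure.restrict_apply_univ]
  rw [← huniv]
  rcases K.subsingleton_or_nontrivial with hsub | hnt
  · have : ν = 0 := by
      rw [← Measure.measure_univ_eq_zero, huniv]
      have := Measure.nullSingletonClass_hausdorff M (d := 1) one_pos
      exact hsub.measure_zero _
    simp [this]
  have hne := hnt.nonempty
  obtain ⟨x₀, hx₀⟩ := hne
  by_cases htop : Metric.ediam K = ⊤
  · have : ν Set.univ = ⊤ := by
      refine ENNReal.eq_top_of_forall_nnreal_le fun r => ?_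
      have hr : 0 < ((r : ℝ) + 1) * C := by positivity
      have h1 := (hreg x₀ hx₀ (((r : ℝ) + 1) * C) hr (by rw [htop]; exact le_top)).1
      rw [mul_div_cancel_right₀ _ hC.ne'] at h1
      refine le_trans ?_ (h1.trans (measure_mono (Set.subset_univ _)))
      rw [← ENNReal.ofReal_coe_nnreal]
      exact ENNReal.ofReal_le_ofReal (by linarith)
    -- The summand `1` in the constant keeps it nonzero, so the right side is infinite for unbounded
    -- `K`.
    rw [this, ENNReal.mul_top (by positivity)]
    exact le_top
  have hδ : Metric.ediam K = ENNReal.ofReal (Metric.diam K) := by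
    rw [Metric.diam, ENNReal.ofReal_toReal htop]
  set δ := Metric.diam K with hδdef
  have hδ0 : 0 < δ := by
    rw [hδdef, Metric.diam]
    refine ENNReal.toReal_pos ?_ htop
    rw [Ne, Metric.ediam_eq_zero_iff]
    exact Set.not_subsingleton_iff.2 hnt
  have hbdd : Bornology.IsBounded K := Metric.isBounded_iff_ediam_ne_top.2 htop
  -- The endpoint `r = diam K` of the regularity condition bounds the total mass, and then the upper
  -- bound holds for all radii.
  have hunivle : ν Set.univ ≤ ENNReal.ofReal (C * δ) := by
    refine le_trans (le_of_eq ?_) (hreg x₀ hx₀ δ hδ0 hδ.ge).2.le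
    rw [huniv, Measure.restrict_apply Metric.isClosed_closedBall.measurableSet,
      Set.inter_eq_right.2]
    exact fun y hy => Metric.dist_le_diam_of_mem hbdd hy hx₀
  have hup : ∀ x ∈ K, ∀ r, 0 < r → ν (Metric.closedBall x r) ≤ ENNReal.ofReal (C * r) := by
    intro x hx r hr
    rcases le_total r δ with hrδ | hrδ
    · exact (hreg x hx r hr (by rw [hδ]; exact ENNReal.ofReal_le_ofReal hrδ)).2.le
    · exact (measure_mono (Set.subset_univ _)).trans
        (hunivle.trans (ENNReal.ofReal_le_ofReal (by gcongr)))
  -- As `K` need not be measurable, almost every point is only placed in its closure.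
  have hae : ∀ᵐ x ∂ν, x ∈ closure K := by
    rw [ae_iff]
    change ν (closure K)ᶜ = 0
    rw [hν, Measure.restrict_apply isClosed_closure.measurableSet.compl]
    rw [Set.inter_comm, ← Set.sdiff_eq, Set.sdiff_eq_empty.2 subset_closure, measure_empty]
  have hfin : ν Set.univ ≠ ⊤ := (hunivle.trans_lt ENNReal.ofReal_lt_top).ne
  have hdisc : ∀ j : ℕ, ∃ π : SimpleFunc M M, (∀ y ∈ closure K, dist (π y) y ≤ δ / (j + 1)) ∧
      ∫⁻ x, ∫⁻ y, ∫⁻ z, ENNReal.ofReal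
        (minExcess (π x) (π y) (π z) / Metric.diam {π x, π y, π z} ^ 3) ∂ν ∂ν ∂ν ≤
      ENNReal.ofReal (integralConst C) * ν Set.univ := by
    intro j
    refine exists_discretization hK ⟨x₀, hx₀⟩ hae hC (by positivity) hfin (fun x hx => ?_) hup
    refine (hreg x hx _ (by positivity) ?_).1
    rw [hδ]
    refine ENNReal.ofReal_le_ofReal ?_
    rw [div_div, div_le_iff₀ (by positivity)]
    have : 0 ≤ δ * j := by positivity
    linarith
  choose π hπ hint using hdisc
  have hlim : ∀ x ∈ closure K, Tendsto (fun j => π j x) atTop (𝓝 x) := by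
    intro x hx
    rw [tendsto_iff_dist_tendsto_zero]
    refine squeeze_zero (fun _ => dist_nonneg) (fun j => hπ j x hx) ?_
    exact tendsto_const_div_atTop_nhds_zero_nat δ |>.comp (tendsto_add_atTop_nat 1) |>.congr
      fun j => by simp
  refine (lintegral_triple_le_of_discretization (π := π)
    (f := fun x y z => ENNReal.ofReal (minExcess x y z / Metric.diam {x, y, z} ^ 3)) hae
    (fun x hx y hy z hz => ?_) hint).trans ?_
  -- On the diagonal the integrand is `0` by division by zero; elsewhere it is continuous.
  · by_cases hd : Metric.diam {x, y, z} = 0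
    · simp [hd]
    · exact (ENNReal.tendsto_ofReal (tendsto_minExcess_div_diam (hlim x hx) (hlim y hy)
        (hlim z hz) hd)).liminf_eq.ge
  · gcongr
    rw [ENNReal.coe_add]
    exact le_self_add

end Regular

/-! ### Menger curvature -/

section Curvature

variable {M : Type*} [MetricSpace M]

/-- Heron's formula for the Menger curvature. -/
theorem mengerCurvature_sq_eq {x y z : M} {T : Affine.Triangle ℝ ℂ}
    (hT : IsComparisonTriangle x y z T) (hxy : 0 < dist x y) (hyz : 0 < dist y z)
    (hxz : 0 < dist x z) :
    mengerCurvature x y z ^ 2 =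
      (dist x y + dist y z + dist x z) * (dist x y + dist y z - dist x z) *
        (dist x z + dist x y - dist y z) * (dist x z + dist y z - dist x y) /
        (dist x y * dist y z * dist x z) ^ 2 := by
  have h := Affine.Triangle.dist_div_sin_angle_eq_two_mul_circumradius T
    (i₁ := 0) (i₂ := 1) (i₃ := 2) (by decide) (by decide) (by decide)
  set θ := EuclideanGeometry.angle (T.points 0) (T.points 1) (T.points 2) with hθ
  have hcos := EuclideanGeometry.law_cos (T.points 0) (T.points 1) (T.points 2)
  rw [← hθ] at hcos
  rw [dist_comm (T.points 2) (T.points 1), hT.1, hT.2.1, hT.2.2] at hcos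
  rw [hT.2.2] at h
  rw [mengerCurvature_eq hT]
  set a := dist x y
  set b := dist y z
  set c := dist x z
  have hR : 0 < T.circumradius := Affine.Simplex.circumradius_pos T
  have hsin : Real.sin θ ≠ 0 := by
    intro h0
    rw [h0, div_zero] at h
    linarith
  rw [div_eq_iff hsin] at h
  have hc : Real.cos θ = (a ^ 2 + b ^ 2 - c ^ 2) / (2 * a * b) := by
    rw [eq_div_iff (by positivity)]
    linarith
  have hs : Real.sin θ ^ 2 = 1 - Real.cos θ ^ 2 := by
    have := Real.sin_sq_add_cos_sq θ
    linarith
  have h1 : (1 / T.circumradius) ^ 2 = 4 * Real.sin θ ^ 2 / c ^ 2 := by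
    rw [h]
    field_simp
    norm_num
  rw [h1, hs, hc]
  field_simp
  ring

/-- In Heron's formula the factor `a + b - c` is the excess for the longest side `c`; the other
factors are at most `3 * c`, `2 * c`, `2 * c`, and comparability gives `a, b ≥ c / A` in the
denominator. -/
theorem mengerCurvature_sq_le {A : ℝ} (hA : 1 < A) {x y z : M}
    (h : (x, y, z) ∈ comparableTriples M A) :
    mengerCurvature x y z ^ 2 ≤
      12 * A ^ 4 * (minExcess x y z / Metric.diam {x, y, z} ^ 3) := by
  obtain ⟨h1, h2, h3⟩ := h
  dsimp only at h1 h2 h3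
  by_cases hT : ∃ T : Affine.Triangle ℝ ℂ, IsComparisonTriangle x y z T
  · obtain ⟨T, hT⟩ := hT
    have hxy : 0 < dist x y := by
      rw [← hT.1]
      exact dist_pos.2 (T.independent.injective.ne (by decide))
    have hdiam : Metric.diam {x, y, z} = dist x z := by
      rw [Metric.diam_triple, max_eq_right (h1.trans h2), max_eq_left h2]
    rw [mengerCurvature_sq_eq hT hxy (by linarith) (by linarith), hdiam,
      minExcess_eq_excess h1 h2]
    have htri := dist_triangle x y z
    unfold excess
    set a := dist x y
    set b := dist y z
    set c := dist x z
    have hc : 0 < c := by linarith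
    have hb : 0 < b := by linarith
    have hac : c / A ≤ a := by
      rw [div_le_iff₀ (by linarith)]
      linarith
    have hbc : c / A ≤ b := hac.trans h1
    calc _ ≤ (3 * c) * (a + b - c) * (2 * c) * (2 * c) / (c / A * (c / A) * c) ^ 2 := by
          gcongr <;> linarith
      _ = _ := by
          field_simp
          ring
  · have : mengerCurvature x y z = 0 := by
      unfold mengerCurvature
      rw [dif_neg hT]
    rw [this, zero_pow two_ne_zero]
    have := minExcess_nonneg x y z
    have : 0 ≤ Metric.diam {x, y, z} := Metric.diam_nonneg
    positivity

end Curvature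

theorem mainTheorem2 (C : ℝ) :
    (∃ c₁ : ℝ≥0, ∀ (M : Type u) [MetricSpace M] [MeasurableSpace M] [BorelSpace M] (Γ : Set M),
      IsPreconnected Γ → IsOneAhlforsRegular C Γ →
        ∫⁻ x in Γ, ∫⁻ y in Γ, ∫⁻ z in Γ,
            ENNReal.ofReal (minExcess x y z / Metric.diam {x, y, z} ^ 3)
              ∂(Measure.hausdorffMeasure 1) ∂(Measure.hausdorffMeasure 1)
              ∂(Measure.hausdorffMeasure 1)
          ≤ c₁ * Measure.hausdorffMeasure 1 Γ) ∧
    (∀ A : ℝ, 1 < A → ∃ c₂ : ℝ≥0,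
      ∀ (M : Type u) [MetricSpace M] [MeasurableSpace M] [BorelSpace M] (Γ : Set M),
        IsPreconnected Γ → IsOneAhlforsRegular C Γ →
          ∫⁻ x in Γ, ∫⁻ y in Γ, ∫⁻ z in Γ,
              (comparableTriples M A).indicator
                (fun p => ENNReal.ofReal (mengerCurvature p.1 p.2.1 p.2.2 ^ 2)) (x, y, z)
                ∂(Measure.hausdorffMeasure 1) ∂(Measure.hausdorffMeasure 1)
                ∂(Measure.hausdorffMeasure 1)
            ≤ c₂ * Measure.hausdorffMeasure 1 Γ) := by
  refine ⟨⟨(integralConst C).toNNReal + 1, fun M _ _ _ Γ hΓ hreg =>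
    lintegral_minExcess_le hΓ hreg⟩, fun A hA => ⟨(12 * A ^ 4).toNNReal *
      ((integralConst C).toNNReal + 1), fun M _ _ _ Γ hΓ hreg => ?_⟩⟩
  have hpt : ∀ x y z : M, (comparableTriples M A).indicator
      (fun p => ENNReal.ofReal (mengerCurvature p.1 p.2.1 p.2.2 ^ 2)) (x, y, z) ≤
      ENNReal.ofReal (12 * A ^ 4) *
        ENNReal.ofReal (minExcess x y z / Metric.diam {x, y, z} ^ 3) := by
    intro x y z
    refine Set.indicator_apply_le' (fun h => ?_) fun _ => bot_le
    rw [← ENNReal.ofReal_mul (by positivity)]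
    exact ENNReal.ofReal_le_ofReal (mengerCurvature_sq_le hA h)
  refine (lintegral_mono fun x => lintegral_mono fun y => lintegral_mono fun z =>
    hpt x y z).trans ?_
  -- The constant is finite, so it can be pulled out without measurability of the integrand.
  simp only [lintegral_const_mul' _ _ ENNReal.ofReal_ne_top]
  rw [ENNReal.coe_mul, mul_assoc]
  exact mul_le_mul' le_rfl (lintegral_minExcess_le hΓ hreg)
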